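/- All vector spaces are over $\mathbb{Q}$ and complexes are cohomologically graded. Let $\Xi$ be a set of colors, $\mathcal{O}$ a $\Xi$-colored (symmetric, unital) dg operad, $\mathcal{Z}(\mathcal{O})\subset\mathcal{O}$ its suboperad of cocycles, and $\mathcal{H}$ a dg operad with an isomorphism of dg operads $H^\bullet(\mathcal{O})\cong\mathcal{H}$, where $H^\bullet(\mathcal{O})$ has zero differential; let $\pi_{\mathcal{H}}:\mathcal{Z}(\mathcal{O})\to H^\bullet(\mathcal{O})\cong\mathcal{H}$ be the projection. Let $P$ be a $\Xi$-colored dg pseudo-cooperad with comultiplications $\Delta_{\mathbf t}$, let $P^{\diamondsuit}$ be the dg cooperad obtained from $P$ by adjoining the counit, and let $$\rho:\mathrm{Cobar}(P^{\diamondsuit})\to\mathcal{H}$$ be a quasi-isomorphism of dg operads. Here $\mathrm{Cobar}(P^{\diamondsuit})$ is the free operad on the suspension $\mathbf{s}P$ with the differential determined by $\partial(\mathbf{s}X)=-\mathbf{s}\,\partial_P X-\sum_{\mathbf t}\sum(-1)^{|X'|}\,\mathbf{s}X'\circ_{\mathbf t}\mathbf{s}X''$, where $\mathbf t$ runs over the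 isomorphism classes of leaf-labelled trees with two nodal vertices and $\Delta_{\mathbf t}X=\sum X'\otimes X''$. Assume: * (C1) there is a grading by subcollections $P=\bigoplus_{k\ge1}\mathcal{G}^kP$, with $\mathcal{G}^{\le 0}P=0$, such that $\partial_P(\mathcal{G}^kP)\subset\mathcal{G}^{k-1}P$ and $\Delta_{\mathbf t}(\mathcal{G}^mP)\subset\bigoplus_{r_1+\dots+r_q=m}\mathcal{G}^{r_1}P\otimes\dots\otimes\mathcal{G}^{r_q}P$ for every tree $\mathbf t$ with $q$ nodal vertices; * (C2) every $\mathcal{G}^kP$ is finite dimensional, and for every $\Xi$-colored corolla $\mathbf q$ the graded components of $\mathcal{O}(\mathbf q)$ are finite dimensional; * (C3) the operad $\mathcal{H}$ is generated by $\rho(\mathbf{s}\,\mathcal{G}^1P)$, and $\rho|_{\mathbf{s}\,\mathcal{G}^kP}=0$ for all $k\ge2$. For a dg operad $\mathcal{Q}$ let $\mathrm{Conv}(P,\mathcal{Q})$ be the convolution dg Lie algebra: its degree $a$ elements are the equivariant families of degree $a$ linear maps $P(\mathbf q)\to\mathcal{Q}(\mathbf q)$, its differential is $\partial f=\partial_{\mathcal{Q}}f-(-1)^{|f|}f\,\partial_P$,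 and its bracket is $[f,g]=f\bullet g-(-1)^{|f||g|}g\bullet f$, where $(f\bullet g)(X)=\sum_{\mathbf t}\mu_{\mathbf t}\big((f\otimes g)\Delta_{\mathbf t}X\big)$ with $\mathbf t$ as above and $\mu_{\mathbf t}$ the multiplication of $\mathcal{Q}$ along $\mathbf t$. Put $\mathrm{Curv}(\alpha)=\partial\alpha+\tfrac12[\alpha,\alpha]$ for $\alpha$ of degree $1$, and let $\alpha_{\mathcal{H}}\in\mathrm{Conv}(P,\mathcal{H})$, $\alpha_{\mathcal{H}}(X)=\rho(\mathbf{s}X)$, be the Maurer-Cartan element corresponding to $\rho$. Then there exists a second MC-sprout $\alpha\in\mathrm{Conv}(P,\mathcal{O})$, that is, a degree $1$ element with $\mathrm{Curv}(\alpha)(X)=0$ for all $X\in\mathcal{G}^{1}P\oplus\mathcal{G}^2P$, such that $\alpha(\mathcal{G}^1P)\subset\mathcal{Z}(\mathcal{O})$ and $\pi_{\mathcal{H}}(\alpha(X))=\alpha_{\mathcal{H}}(X)$ for all $X\in\mathcal{G}^1P$. (It is not assumed that $\mathcal{O}$ is formal.) -/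

import Mathlib

open scoped TensorProduct

universe x u v w

/-! ## Coloured corollas and labelled trees with two nodal vertices -/

/-- A `Ξ`-coloured corolla with the standard labelling of its incoming edges. -/
structure Corolla (Ξ : Type x) where
  arity : ℕ
  input : Fin arity → Ξ
  output : Ξ

namespace Corolla

variable {Ξ : Type x}

/-- A colour preserving relabelling of the incoming edges. The automorphism group of a corolla `q` is
the product of symmetric groups permuting the incoming edges of equal colour, and every corolla is
isomorphic to one whose incoming edges are sorted by colour. -/
structure Iso (q q' : Corolla Ξ) where
  perm : Fin q.arity ≃ Fin q'.arity
  input_eq : ∀ i, q'.input (perm i) = q.input i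
  output_eq : q'.output = q.output

/-- The identity relabelling. -/
def Iso.refl (q : Corolla Ξ) : Iso q q := ⟨Equiv.refl _, fun _ => rfl, rfl⟩

/-- Composition of relabellings. -/
def Iso.trans {q q' q'' : Corolla Ξ} (σ : Iso q q') (τ : Iso q' q'') : Iso q q'' :=
  ⟨σ.perm.trans τ.perm, fun i => (τ.input_eq _).trans (σ.input_eq i),
    τ.output_eq.trans σ.output_eq⟩

/-- The inverse relabelling. -/
def Iso.symm {q q' : Corolla Ξ} (σ : Iso q q') : Iso q' q :=
  ⟨σ.perm.symm, fun i => by rw [← σ.input_eq, Equiv.apply_symm_apply], σ.output_eq.symm⟩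

/-- The corolla with one incoming edge, both edges having colour `c`. -/
def unit (c : Ξ) : Corolla Ξ := ⟨1, fun _ => c, c⟩

end Corolla

/-- A `Ξ`-coloured planar tree with exactly two nodal vertices, whose leaves are labelled by the
incoming edges of the corolla `q`: the lower vertex is the corolla `r`, and the upper vertex is the
corolla `u`, whose outgoing edge is glued to the incoming edge `leg` of `r`. The map `leaf` sends the
edge `leg` to `none`, and every other incoming edge of the two vertices to its label. -/
structure Graft {Ξ : Type x} (r u q : Corolla Ξ) where
  leg : Fin r.arity
  leaf : Fin r.arity ⊕ Fin u.arity ≃ Option (Fin q.arity)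
  leaf_leg : leaf (Sum.inl leg) = none
  leg_color : r.input leg = u.output
  output_color : r.output = q.output
  lower_color : ∀ i k, leaf (Sum.inl i) = some k → r.input i = q.input k
  upper_color : ∀ j k, leaf (Sum.inr j) = some k → u.input j = q.input k

namespace Graft

variable {Ξ : Type x}

/-- Relabellings of the two vertices and of the leaves which carry the tree `g` to the tree `g'`. -/
def Compat {r u q r' u' q' : Corolla Ξ} (σ : r.Iso r') (τ : u.Iso u') (κ : q.Iso q')
    (g : Graft r u q) (g' : Graft r' u' q') : Prop :=
  ∀ s, g'.leaf (Sum.map σ.perm τ.perm s) = Option.map κ.perm (g.leaf s)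

/-- Contracting either edge of one and the same labelled tree with three nodal vertices, where `u` is
grafted on `r` and `v` is grafted on `u`: the pair `(a, b)` contracts the edge between `u` and `v`
first, and the pair `(c, d)` contracts the edge between `r` and `u` first. -/
structure Sequential {r u v w m q : Corolla Ξ} (a : Graft r w q) (b : Graft u v w)
    (c : Graft m v q) (d : Graft r u m) : Prop where
  leg_eq : d.leg = a.leg
  lower : ∀ i k, d.leaf (Sum.inl i) = some k → c.leaf (Sum.inl k) = a.leaf (Sum.inl i)
  middle : ∀ j k, d.leaf (Sum.inr j) = some k →
    c.leaf (Sum.inl k) = (b.leaf (Sum.inl j)).bind fun l => a.leaf (Sum.inr l)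
  upper : ∀ l, c.leaf (Sum.inr l) = (b.leaf (Sum.inr l)).bind fun l => a.leaf (Sum.inr l)

/-- Contracting either edge of one and the same labelled tree with three nodal vertices, where `u`
and `v` are grafted on two different edges of `r`: the pair `(a, b)` contracts the edge between `r`
and `u` first, and the pair `(c, d)` contracts the edge between `r` and `v` first. -/
structure Parallel {r u v m m' q : Corolla Ξ} (a : Graft r u m) (b : Graft m v q)
    (c : Graft r v m') (d : Graft m' u q) : Prop where
  leg_right : a.leaf (Sum.inl c.leg) = some b.leg
  leg_left : c.leaf (Sum.inl a.leg) = some d.leg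
  lower : ∀ i k k', a.leaf (Sum.inl i) = some k → c.leaf (Sum.inl i) = some k' →
    b.leaf (Sum.inl k) = d.leaf (Sum.inl k')
  left : ∀ j k, a.leaf (Sum.inr j) = some k → b.leaf (Sum.inl k) = d.leaf (Sum.inr j)
  right : ∀ l k, c.leaf (Sum.inr l) = some k → d.leaf (Sum.inl k) = b.leaf (Sum.inr l)

theorem Compat.symm {r u q r' u' q' : Corolla Ξ} {σ : r.Iso r'} {τ : u.Iso u'} {κ : q.Iso q'}
    {g : Graft r u q} {g' : Graft r' u' q'} (h : Compat σ τ κ g g') :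
    Compat σ.symm τ.symm κ.symm g' g := by
  intro s
  have h1 := h (Sum.map σ.perm.symm τ.perm.symm s)
  have h2 : Sum.map σ.perm τ.perm (Sum.map σ.perm.symm τ.perm.symm s) = s := by
    cases s <;> simp
  rw [h2] at h1
  rw [h1]
  simp [Corolla.Iso.symm, Option.map_map, Function.comp_def]

theorem Compat.trans {r u q r' u' q' r'' u'' q'' : Corolla Ξ} {σ : r.Iso r'} {τ : u.Iso u'}
    {κ : q.Iso q'} {σ' : r'.Iso r''} {τ' : u'.Iso u''} {κ' : q'.Iso q''}
    {g : Graft r u q} {g' : Graft r' u' q'} {g'' : Graft r'' u'' q''}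
    (h : Compat σ τ κ g g') (h' : Compat σ' τ' κ' g' g'') :
    Compat (σ.trans σ') (τ.trans τ') (κ.trans κ') g g'' := by
  intro s
  have h1 := h' (Sum.map σ.perm τ.perm s)
  rw [h s] at h1
  have h2 : Sum.map (σ.trans σ').perm (τ.trans τ').perm s =
      Sum.map σ'.perm τ'.perm (Sum.map σ.perm τ.perm s) := by
    cases s <;> simp [Corolla.Iso.trans]
  rw [h2, h1]
  simp [Corolla.Iso.trans, Option.map_map, Function.comp_def]

theorem Compat.congr {r u q r' u' q' : Corolla Ξ} {σ σ' : r.Iso r'} {τ τ' : u.Iso u'}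
    {κ κ' : q.Iso q'} {g : Graft r u q} {g' : Graft r' u' q'} (h : Compat σ τ κ g g')
    (hσ : σ.perm = σ'.perm) (hτ : τ.perm = τ'.perm) (hκ : κ.perm = κ'.perm) :
    Compat σ' τ' κ' g g' := by
  intro s
  rw [← hσ, ← hτ, ← hκ]
  exact h s

/-- Relabelling the leaves of a tree. -/
def relabel {r u q q' : Corolla Ξ} (κ : q.Iso q') (g : Graft r u q) : Graft r u q' where
  leg := g.leg
  leaf := g.leaf.trans (Equiv.optionCongr κ.perm)
  leaf_leg := by simp [g.leaf_leg]
  leg_color := g.leg_color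
  output_color := g.output_color.trans κ.output_eq.symm
  lower_color := by
    intro i k h
    obtain ⟨l, hl, rfl⟩ : ∃ l, g.leaf (Sum.inl i) = some l ∧ κ.perm l = k := by simpa using h
    rw [κ.input_eq, g.lower_color i l hl]
  upper_color := by
    intro i k h
    obtain ⟨l, hl, rfl⟩ : ∃ l, g.leaf (Sum.inr i) = some l ∧ κ.perm l = k := by simpa using h
    rw [κ.input_eq, g.upper_color i l hl]

theorem compat_relabel {r u q q' : Corolla Ξ} (κ : q.Iso q') (g : Graft r u q) :
    Compat (Corolla.Iso.refl r) (Corolla.Iso.refl u) κ g (g.relabel κ) := by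
  intro s
  cases s <;> simp [Corolla.Iso.refl, relabel]

end Graft

/-- The labelled trees with two nodal vertices and with leaves labelled by the incoming edges
of `q`. -/
structure TwoTree {Ξ : Type x} (q : Corolla Ξ) where
  lower : Corolla Ξ
  upper : Corolla Ξ
  graft : Graft lower upper q

namespace TwoTree

variable {Ξ : Type x}

/-- Two labelled trees are identified if they are related by a (not necessarily planar) isomorphism
which respects the labels of the leaves. -/
instance setoid (q : Corolla Ξ) : Setoid (TwoTree q) where
  r s t := ∃ (σ : s.lower.Iso t.lower) (τ : s.upper.Iso t.upper),
    Graft.Compat σ τ (Corolla.Iso.refl q) s.graft t.graft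
  iseqv :=
    { refl := fun s => ⟨Corolla.Iso.refl _, Corolla.Iso.refl _, by
        intro e; cases e <;> simp [Corolla.Iso.refl]⟩
      symm := by
        rintro s t ⟨σ, τ, h⟩
        exact ⟨σ.symm, τ.symm, h.symm⟩
      trans := by
        rintro s t z ⟨σ, τ, h⟩ ⟨σ', τ', h'⟩
        exact ⟨σ.trans σ', τ.trans τ', h.trans h'⟩ }

/-- Isomorphism classes of labelled trees with two nodal vertices. -/
abbrev Class (q : Corolla Ξ) : Type x := Quotient (TwoTree.setoid q)

/-- Relabelling the leaves. -/
def relabel {q q' : Corolla Ξ} (κ : q.Iso q') (t : TwoTree q) : TwoTree q' :=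
  ⟨t.lower, t.upper, t.graft.relabel κ⟩

/-- Relabelling the leaves of isomorphism classes. -/
def Class.relabel {q q' : Corolla Ξ} (κ : q.Iso q') : Class q → Class q' :=
  Quotient.map (TwoTree.relabel κ) (by
    rintro s t ⟨σ, τ, h⟩
    refine ⟨σ, τ, (((Graft.compat_relabel κ s.graft).symm.trans h).trans
      (Graft.compat_relabel κ t.graft)).congr ?_ ?_ ?_⟩ <;>
    ext e <;> simp [Corolla.Iso.refl, Corolla.Iso.trans, Corolla.Iso.symm])

theorem Class.relabel_relabel_symm {q q' : Corolla Ξ} (κ : q.Iso q') (z : Class q) :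
    Class.relabel κ.symm (Class.relabel κ z) = z := by
  induction z using Quotient.inductionOn with
  | _ t =>
    refine Quotient.sound ⟨Corolla.Iso.refl _, Corolla.Iso.refl _, ?_⟩
    refine (((Graft.compat_relabel κ t.graft).trans
      (Graft.compat_relabel κ.symm (t.graft.relabel κ))).symm).congr ?_ ?_ ?_
    · rfl
    · rfl
    · ext e
      simp [Corolla.Iso.refl, Corolla.Iso.trans, Corolla.Iso.symm]

/-- Relabelling the leaves is a bijection on isomorphism classes. -/
def Class.relabelEquiv {q q' : Corolla Ξ} (κ : q.Iso q') : Class q ≃ Class q' where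
  toFun := Class.relabel κ
  invFun := Class.relabel κ.symm
  left_inv := Class.relabel_relabel_symm κ
  right_inv := Class.relabel_relabel_symm κ.symm

theorem Class.exists_compat_out {q q' : Corolla Ξ} (κ : q.Iso q') (z : Class q) :
    ∃ (σ : z.out.lower.Iso (Class.relabelEquiv κ z).out.lower)
      (τ : z.out.upper.Iso (Class.relabelEquiv κ z).out.upper),
      Graft.Compat σ τ κ z.out.graft (Class.relabelEquiv κ z).out.graft := by
  have h : (TwoTree.setoid q').r (TwoTree.relabel κ z.out) (Class.relabelEquiv κ z).out := by
    apply Quotient.exact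
    rw [Quotient.out_eq]
    conv_rhs => rw [← Quotient.out_eq z]
    rfl
  obtain ⟨σ, τ, h⟩ := h
  exact ⟨(Corolla.Iso.refl _).trans σ, (Corolla.Iso.refl _).trans τ,
    (Graft.compat_relabel κ z.out.graft).trans h⟩

end TwoTree

/-! ## Collections, operads and pseudo-cooperads -/

/-- A `Ξ`-coloured collection of cochain complexes of rational vector spaces: `obj q i` is the degree
`i` component of the complex attached to the corolla `q`. -/
structure DGCollection (Ξ : Type x) where
  obj : Corolla Ξ → ℤ → Type u
  [instAddCommGroup : ∀ q i, AddCommGroup (obj q i)]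
  [instModule : ∀ q i, Module ℚ (obj q i)]
  map : ∀ {q q' : Corolla Ξ} {i : ℤ}, q.Iso q' → (obj q i →ₗ[ℚ] obj q' i)
  map_refl : ∀ {q : Corolla Ξ} {i : ℤ} (y : obj q i), map (Corolla.Iso.refl q) y = y
  map_trans : ∀ {q q' q'' : Corolla Ξ} {i : ℤ} (σ : q.Iso q') (τ : q'.Iso q'') (y : obj q i),
    map (σ.trans τ) y = map τ (map σ y)
  d : ∀ {q : Corolla Ξ} {i j : ℤ}, i + 1 = j → (obj q i →ₗ[ℚ] obj q j)
  d_d : ∀ {q : Corolla Ξ} {i j k : ℤ} (hi : i + 1 = j) (hj : j + 1 = k) (y : obj q i),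
    d hj (d hi y) = 0
  d_map : ∀ {q q' : Corolla Ξ} {i j : ℤ} (h : i + 1 = j) (σ : q.Iso q') (y : obj q i),
    d h (map σ y) = map σ (d h y)

attribute [instance] DGCollection.instAddCommGroup DGCollection.instModule

/-- A `Ξ`-coloured dg operad over the rationals. The operation `comp g` is the multiplication
attached to the labelled planar tree `g` with two nodal vertices. -/
structure DGOperad (Ξ : Type x) extends DGCollection.{x, u} Ξ where
  comp : ∀ {r u q : Corolla Ξ} {i j k : ℤ}, Graft r u q → i + j = k →
    (obj r i →ₗ[ℚ] obj u j →ₗ[ℚ] obj q k)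
  one : ∀ c : Ξ, obj (Corolla.unit c) 0
  comp_map : ∀ {r u q r' u' q' : Corolla Ξ} {i j k : ℤ} {σ : r.Iso r'} {τ : u.Iso u'}
    {κ : q.Iso q'} {g : Graft r u q} {g' : Graft r' u' q'} (h : i + j = k),
    Graft.Compat σ τ κ g g' → ∀ (y : obj r i) (z : obj u j),
    comp g' h (map σ y) (map τ z) = map κ (comp g h y z)
  comp_sequential : ∀ {r u v w m q : Corolla Ξ} {a : Graft r w q} {b : Graft u v w}
    {c : Graft m v q} {e : Graft r u m}, Graft.Sequential a b c e →
    ∀ {i j k ij jk ijk : ℤ} (hij : i + j = ij) (hjk : j + k = jk) (hl : ij + k = ijk)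
      (hr : i + jk = ijk) (y : obj r i) (z : obj u j) (t : obj v k),
    comp c hl (comp e hij y z) t = comp a hr y (comp b hjk z t)
  comp_parallel : ∀ {r u v m m' q : Corolla Ξ} {a : Graft r u m} {b : Graft m v q}
    {c : Graft r v m'} {e : Graft m' u q}, Graft.Parallel a b c e →
    ∀ {i j k ij ik ijk : ℤ} (hij : i + j = ij) (hik : i + k = ik) (hl : ij + k = ijk)
      (hr : ik + j = ijk) (y : obj r i) (z : obj u j) (t : obj v k),
    comp b hl (comp a hij y z) t = ((-1 : ℚ) ^ (j * k)) • comp e hr (comp c hik y t) z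
  comp_one : ∀ {r q : Corolla Ξ} {c : Ξ} (g : Graft r (Corolla.unit c) q) (σ : r.Iso q),
    (∀ i k, g.leaf (Sum.inl i) = some k → σ.perm i = k) →
    (∀ j, g.leaf (Sum.inr j) = some (σ.perm g.leg)) →
    ∀ {i : ℤ} (h : i + 0 = i) (y : obj r i), comp g h y (one c) = map σ y
  one_comp : ∀ {u q : Corolla Ξ} {c : Ξ} (g : Graft (Corolla.unit c) u q) (σ : u.Iso q),
    (∀ j, g.leaf (Sum.inr j) = some (σ.perm j)) →
    ∀ {i : ℤ} (h : 0 + i = i) (y : obj u i), comp g h (one c) y = map σ y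
  d_comp : ∀ {r u q : Corolla Ξ} (g : Graft r u q) {i i' j j' k k' : ℤ} (hi : i + 1 = i')
    (hj : j + 1 = j') (hk : k + 1 = k') (h : i + j = k) (hl : i' + j = k') (hr : i + j' = k')
    (y : obj r i) (z : obj u j),
    d hk (comp g h y z) =
      comp g hl (d hi y) z + ((-1 : ℚ) ^ i) • comp g hr y (d hj z)
  d_one : ∀ (c : Ξ) {j : ℤ} (h : 0 + 1 = j), d h (one c) = 0

/-- A `Ξ`-coloured dg pseudo-cooperad over the rationals. For a labelled planar tree `g` with two
nodal vertices, `cocomp g` is the component of the comultiplication `Δ_g` in bidegree `(i, j)`. The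
comultiplications of an element are jointly an element of a direct sum over the isomorphism classes of
trees and over the bidegrees, that is, finitely many of them do not vanish. -/
structure DGPseudoCooperad (Ξ : Type x) extends DGCollection.{x, v} Ξ where
  cocomp : ∀ {r u q : Corolla Ξ} {i j k : ℤ}, Graft r u q → i + j = k →
    (obj q k →ₗ[ℚ] obj r i ⊗[ℚ] obj u j)
  cocomp_map : ∀ {r u q r' u' q' : Corolla Ξ} {i j k : ℤ} {σ : r.Iso r'} {τ : u.Iso u'}
    {κ : q.Iso q'} {g : Graft r u q} {g' : Graft r' u' q'} (h : i + j = k),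
    Graft.Compat σ τ κ g g' → ∀ y : obj q k,
    cocomp g' h (map κ y) = TensorProduct.map (map σ) (map τ) (cocomp g h y)
  cocomp_sequential : ∀ {r u v w m q : Corolla Ξ} {a : Graft r w q} {b : Graft u v w}
    {c : Graft m v q} {e : Graft r u m}, Graft.Sequential a b c e →
    ∀ {i j k ij jk ijk : ℤ} (hij : i + j = ij) (hjk : j + k = jk) (hl : ij + k = ijk)
      (hr : i + jk = ijk) (y : obj q ijk),
    TensorProduct.assoc ℚ (obj r i) (obj u j) (obj v k)
        (TensorProduct.map (cocomp e hij) LinearMap.id (cocomp c hl y)) =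
      TensorProduct.map LinearMap.id (cocomp b hjk) (cocomp a hr y)
  cocomp_parallel : ∀ {r u v m m' q : Corolla Ξ} {a : Graft r u m} {b : Graft m v q}
    {c : Graft r v m'} {e : Graft m' u q}, Graft.Parallel a b c e →
    ∀ {i j k ij ik ijk : ℤ} (hij : i + j = ij) (hik : i + k = ik) (hl : ij + k = ijk)
      (hr : ik + j = ijk) (y : obj q ijk),
    TensorProduct.rightComm ℚ (obj r i) (obj u j) (obj v k)
        (TensorProduct.map (cocomp a hij) LinearMap.id (cocomp b hl y)) =
      ((-1 : ℚ) ^ (j * k)) •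
        TensorProduct.map (cocomp c hik) LinearMap.id (cocomp e hr y)
  cocomp_d : ∀ {r u q : Corolla Ξ} (g : Graft r u q) {i i' j j' k k' : ℤ} (hi : i + 1 = i')
    (hj : j + 1 = j') (hk : k + 1 = k') (h : i' + j' = k') (hl : i + j' = k) (hr : i' + j = k)
    (y : obj q k),
    cocomp g h (d hk y) =
      TensorProduct.map (d hi) LinearMap.id (cocomp g hl y) +
        ((-1 : ℚ) ^ i') • TensorProduct.map LinearMap.id (d hj) (cocomp g hr y)
  finite_cocomp : ∀ {q : Corolla Ξ} {k : ℤ} (y : obj q k),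
    {p : TwoTree.Class q × ℤ |
      cocomp p.1.out.graft (add_sub_cancel p.2 k) y ≠ 0}.Finite

/-! ## The convolution Lie algebra -/

section Convolution

variable {Ξ : Type x}

/-- The degree `a` component of the convolution Lie algebra `Conv(P, O)`: families of linear maps of
degree `a` commuting with the relabellings. -/
def Conv (P : DGPseudoCooperad.{x, v} Ξ) (O : DGOperad.{x, u} Ξ) (a : ℤ) :
    Submodule ℚ (∀ (q : Corolla Ξ) (i : ℤ), P.obj q i →ₗ[ℚ] O.obj q (i + a)) where
  carrier := {f | ∀ (q q' : Corolla Ξ) (i : ℤ) (σ : q.Iso q') (y : P.obj q i),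
    f q' i (P.map σ y) = O.map σ (f q i y)}
  add_mem' := by
    intro f g hf hg q q' i σ y
    simp [hf q q' i σ y, hg q q' i σ y]
  zero_mem' := by
    intro q q' i σ y
    simp
  smul_mem' := by
    intro c f hf q q' i σ y
    simp [hf q q' i σ y]

namespace Conv

variable {P : DGPseudoCooperad.{x, v} Ξ} {O : DGOperad.{x, u} Ξ}

/-- The linear map `P(q)^i → O(q)^j`, `j = i + a`, which belongs to an element of degree `a`. -/
def app {a : ℤ} (f : Conv P O a) {q : Corolla Ξ} {i j : ℤ} (h : i + a = j) :
    P.obj q i →ₗ[ℚ] O.obj q j := h ▸ f.1 q i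

theorem app_map {a : ℤ} (f : Conv P O a) {q q' : Corolla Ξ} {i j : ℤ} (h : i + a = j)
    (σ : q.Iso q') (y : P.obj q i) : app f h (P.map σ y) = O.map σ (app f h y) := by
  subst h
  exact f.2 q q' i σ y

/-- The contribution of the tree `t` and of the bidegree `(i, k - i)` to `f • g`, namely
`μ_t ∘ (f ⊗ g) ∘ Δ_t`, where `(f ⊗ g)(y ⊗ z) = (-1)^{|g||y|} f(y) ⊗ g(z)`. -/
def preLieTerm {a b c : ℤ} (hc : a + b = c) (f : Conv P O a) (g : Conv P O b) {q : Corolla Ξ}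
    (t : TwoTree q) (i : ℤ) {k l : ℤ} (h : k + c = l) : P.obj q k →ₗ[ℚ] O.obj q l :=
  ((-1 : ℚ) ^ (b * i)) •
    (TensorProduct.lift (O.comp t.graft (show (i + a) + ((k - i) + b) = l by omega)) ∘ₗ
      TensorProduct.map (app f rfl) (app g rfl) ∘ₗ P.cocomp t.graft (add_sub_cancel i k))

theorem preLieTerm_map {a b c : ℤ} (hc : a + b = c) (f : Conv P O a) (g : Conv P O b)
    {q q' : Corolla Ξ} {s : TwoTree q} {t : TwoTree q'} {σ : s.lower.Iso t.lower}
    {τ : s.upper.Iso t.upper} {κ : q.Iso q'} (H : Graft.Compat σ τ κ s.graft t.graft)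
    (i : ℤ) {k l : ℤ} (h : k + c = l) (y : P.obj q k) :
    preLieTerm hc f g t i h (P.map κ y) = O.map κ (preLieTerm hc f g s i h y) := by
  simp only [preLieTerm, LinearMap.smul_apply, LinearMap.comp_apply, map_smul,
    P.cocomp_map _ H]
  congr 1
  induction P.cocomp s.graft (add_sub_cancel i k) y using TensorProduct.induction_on with
  | zero => simp
  | tmul y z => simp [app_map, O.comp_map _ H]
  | add y z hy hz => simp only [map_add, hy, hz]

theorem finite_support_preLieTerm {a b c : ℤ} (hc : a + b = c) (f : Conv P O a) (g : Conv P O b)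
    {q : Corolla Ξ} {k l : ℤ} (h : k + c = l) (y : P.obj q k) :
    (Function.support fun p : TwoTree.Class q × ℤ =>
      preLieTerm hc f g p.1.out p.2 h y).Finite := by
  refine (P.finite_cocomp y).subset fun p hp => ?_
  intro h0
  apply hp
  simp [preLieTerm, h0]

/-- The pre-Lie product `f • g`: the sum of `μ_t ∘ (f ⊗ g) ∘ Δ_t` over the isomorphism classes of
labelled trees `t` with two nodal vertices. -/
noncomputable def preLie {a b c : ℤ} (hc : a + b = c) (f : Conv P O a) (g : Conv P O b) :
    Conv P O c :=
  ⟨fun q k =>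
    { toFun := fun y => ∑ᶠ p : TwoTree.Class q × ℤ, preLieTerm hc f g p.1.out p.2 rfl y
      map_add' := by
        intro y z
        simp only [map_add]
        exact finsum_add_distrib (finite_support_preLieTerm hc f g rfl y)
          (finite_support_preLieTerm hc f g rfl z)
      map_smul' := by
        intro r y
        simp only [map_smul, RingHom.id_apply]
        exact (smul_finsum' r (finite_support_preLieTerm hc f g rfl y)).symm },
   by
    intro q q' k σ y
    change (∑ᶠ p : TwoTree.Class q' × ℤ, preLieTerm hc f g p.1.out p.2 rfl (P.map σ y)) =
      O.map σ (∑ᶠ p : TwoTree.Class q × ℤ, preLieTerm hc f g p.1.out p.2 rfl y)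
    have h1 : O.map σ (∑ᶠ p : TwoTree.Class q × ℤ, preLieTerm hc f g p.1.out p.2 rfl y) =
        ∑ᶠ p : TwoTree.Class q × ℤ, O.map σ (preLieTerm hc f g p.1.out p.2 rfl y) :=
      (O.map σ).toAddMonoidHom.map_finsum (finite_support_preLieTerm hc f g rfl y)
    rw [h1, ← finsum_comp_equiv
      ((TwoTree.Class.relabelEquiv σ).prodCongr (Equiv.refl ℤ))]
    refine finsum_congr fun p => ?_
    obtain ⟨σ', τ', H⟩ := TwoTree.Class.exists_compat_out σ p.1
    exact preLieTerm_map hc f g H p.2 rfl y⟩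

/-- The Lie bracket `[f, g] = f • g - (-1)^{|f||g|} g • f`. -/
noncomputable def bracket {a b c : ℤ} (hc : a + b = c) (f : Conv P O a) (g : Conv P O b) :
    Conv P O c :=
  preLie hc f g - ((-1 : ℚ) ^ (a * b)) • preLie ((add_comm b a).trans hc) g f

/-- The differential `∂f = ∂_O ∘ f - (-1)^{|f|} f ∘ ∂_P`. -/
def differential {a b : ℤ} (hb : a + 1 = b) (f : Conv P O a) : Conv P O b :=
  ⟨fun q i =>
    O.d (show (i + a) + 1 = i + b by omega) ∘ₗ app f rfl -
      ((-1 : ℚ) ^ a) • (app f (show (i + 1) + a = i + b by omega) ∘ₗ P.d rfl),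
   by
    intro q q' i σ y
    simp [app_map, O.d_map, P.d_map]⟩

/-- `Curv(α) = ∂α + ½ [α, α]` for `α` of degree one. -/
noncomputable def curv (α : Conv P O 1) : Conv P O 2 :=
  differential (by norm_num) α + (1 / 2 : ℚ) • bracket (by norm_num) α α

end Conv

end Convolution

/-! ## Morphisms, ideals and quotients, cohomology -/

namespace DGOperad

variable {Ξ : Type x}

/-- Morphisms of dg operads. -/
structure Hom (O : DGOperad.{x, u} Ξ) (Q : DGOperad.{x, v} Ξ) where
  app : ∀ {q : Corolla Ξ} {i : ℤ}, O.obj q i →ₗ[ℚ] Q.obj q i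
  app_map : ∀ {q q' : Corolla Ξ} {i : ℤ} (σ : q.Iso q') (y : O.obj q i),
    app (O.map σ y) = Q.map σ (app y)
  app_d : ∀ {q : Corolla Ξ} {i j : ℤ} (h : i + 1 = j) (y : O.obj q i),
    app (O.d h y) = Q.d h (app y)
  app_one : ∀ c : Ξ, app (O.one c) = Q.one c
  app_comp : ∀ {r u q : Corolla Ξ} {i j k : ℤ} (g : Graft r u q) (h : i + j = k)
    (y : O.obj r i) (z : O.obj u j), app (O.comp g h y z) = Q.comp g h (app y) (app z)

/-- A morphism of dg operads is an isomorphism if all its components are bijective. -/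
def Hom.IsIso {O : DGOperad.{x, u} Ξ} {Q : DGOperad.{x, v} Ξ} (F : Hom O Q) : Prop :=
  ∀ (q : Corolla Ξ) (i : ℤ), Function.Bijective (F.app : O.obj q i → Q.obj q i)

/-- Two-sided dg ideals of a dg operad. -/
structure Ideal (O : DGOperad.{x, u} Ξ) where
  sub : ∀ (q : Corolla Ξ) (i : ℤ), Submodule ℚ (O.obj q i)
  map_mem : ∀ {q q' : Corolla Ξ} {i : ℤ} (σ : q.Iso q') {y : O.obj q i},
    y ∈ sub q i → O.map σ y ∈ sub q' i
  d_mem : ∀ {q : Corolla Ξ} {i j : ℤ} (h : i + 1 = j) {y : O.obj q i},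
    y ∈ sub q i → O.d h y ∈ sub q j
  comp_mem_left : ∀ {r u q : Corolla Ξ} {i j k : ℤ} (g : Graft r u q) (h : i + j = k)
    {y : O.obj r i} (z : O.obj u j), y ∈ sub r i → O.comp g h y z ∈ sub q k
  comp_mem_right : ∀ {r u q : Corolla Ξ} {i j k : ℤ} (g : Graft r u q) (h : i + j = k)
    (y : O.obj r i) {z : O.obj u j}, z ∈ sub u j → O.comp g h y z ∈ sub q k

/-- The quotient of a dg operad by a two-sided dg ideal. -/
def quotient (O : DGOperad.{x, u} Ξ) (I : O.Ideal) : DGOperad.{x, u} Ξ where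
  obj q i := O.obj q i ⧸ I.sub q i
  map {q q' i} σ := (I.sub q i).mapQ (I.sub q' i) (O.map σ) fun _ hy => I.map_mem σ hy
  map_refl := by
    rintro q i ⟨y⟩
    exact congrArg Submodule.Quotient.mk (O.map_refl y)
  map_trans := by
    rintro q q' q'' i σ τ ⟨y⟩
    exact congrArg Submodule.Quotient.mk (O.map_trans σ τ y)
  d {q i j} h := (I.sub q i).mapQ (I.sub q j) (O.d h) fun _ hy => I.d_mem h hy
  d_d := by
    rintro q i j k hi hj ⟨y⟩
    exact congrArg Submodule.Quotient.mk (O.d_d hi hj y)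
  d_map := by
    rintro q q' i j h σ ⟨y⟩
    exact congrArg Submodule.Quotient.mk (O.d_map h σ y)
  comp {r u q i j k} g h :=
    (I.sub r i).liftQ
      { toFun := fun y => (I.sub u j).mapQ (I.sub q k) (O.comp g h y)
          fun _ hz => I.comp_mem_right g h y hz
        map_add' := by
          intro y y'
          ext z
          simp
        map_smul' := by
          intro c y
          ext z
          simp }
      (by
        intro y hy
        ext z
        simpa using I.comp_mem_left g h z hy)
  one c := Submodule.Quotient.mk (O.one c)
  comp_map := by
    rintro r u q r' u' q' i j k σ τ κ g g' h H ⟨y⟩ ⟨z⟩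
    exact congrArg Submodule.Quotient.mk (O.comp_map h H y z)
  comp_sequential := by
    rintro r u v w m q a b c e H i j k ij jk ijk hij hjk hl hr ⟨y⟩ ⟨z⟩ ⟨t⟩
    exact congrArg Submodule.Quotient.mk (O.comp_sequential H hij hjk hl hr y z t)
  comp_parallel := by
    rintro r u v m m' q a b c e H i j k ij ik ijk hij hik hl hr ⟨y⟩ ⟨z⟩ ⟨t⟩
    exact congrArg Submodule.Quotient.mk (O.comp_parallel H hij hik hl hr y z t)
  comp_one := by
    rintro r q c g σ h1 h2 i h ⟨y⟩
    exact congrArg Submodule.Quotient.mk (O.comp_one g σ h1 h2 h y)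
  one_comp := by
    rintro u q c g σ h1 i h ⟨y⟩
    exact congrArg Submodule.Quotient.mk (O.one_comp g σ h1 h y)
  d_comp := by
    rintro r u q g i i' j j' k k' hi hj hk h hl hr ⟨y⟩ ⟨z⟩
    exact congrArg Submodule.Quotient.mk (O.d_comp g hi hj hk h hl hr y z)
  d_one c j h := congrArg Submodule.Quotient.mk (O.d_one c h)

/-- The cocycles of degree `i`. -/
def cocycles (O : DGOperad.{x, u} Ξ) (q : Corolla Ξ) (i : ℤ) : Submodule ℚ (O.obj q i) :=
  LinearMap.ker (O.d (q := q) (rfl : i + 1 = i + 1))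

theorem mem_cocycles {O : DGOperad.{x, u} Ξ} {q : Corolla Ξ} {i j : ℤ} (h : i + 1 = j)
    {y : O.obj q i} : y ∈ O.cocycles q i ↔ O.d h y = 0 := by
  subst h
  exact LinearMap.mem_ker

theorem map_mem_cocycles (O : DGOperad.{x, u} Ξ) {q q' : Corolla Ξ} {i : ℤ} (σ : q.Iso q')
    {y : O.obj q i} (hy : y ∈ O.cocycles q i) : O.map σ y ∈ O.cocycles q' i := by
  rw [mem_cocycles rfl] at hy ⊢
  rw [O.d_map, hy, map_zero]

theorem comp_mem_cocycles (O : DGOperad.{x, u} Ξ) {r u q : Corolla Ξ} {i j k : ℤ}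
    (g : Graft r u q) (h : i + j = k) {y : O.obj r i} {z : O.obj u j}
    (hy : y ∈ O.cocycles r i) (hz : z ∈ O.cocycles u j) : O.comp g h y z ∈ O.cocycles q k := by
  rw [mem_cocycles rfl] at hy hz ⊢
  rw [O.d_comp g rfl rfl rfl h (by omega) (by omega), hy, hz]
  simp

/-- The operad `Z(O)` of cocycles, with the zero differential. -/
def cocycleOperad (O : DGOperad.{x, u} Ξ) : DGOperad.{x, u} Ξ where
  obj q i := O.cocycles q i
  map {q q' i} σ := (O.map σ).restrict fun _ hy => O.map_mem_cocycles σ hy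
  map_refl y := Subtype.ext (O.map_refl _)
  map_trans σ τ y := Subtype.ext (O.map_trans _ _ _)
  d _ := 0
  d_d _ _ _ := rfl
  d_map _ _ _ := by simp
  comp {r u q i j k} g h := LinearMap.mk₂ ℚ
    (fun y z => ⟨O.comp g h y.1 z.1, O.comp_mem_cocycles g h y.2 z.2⟩)
    (fun _ _ _ => Subtype.ext (by simp)) (fun _ _ _ => Subtype.ext (by simp))
    (fun _ _ _ => Subtype.ext (by simp)) (fun _ _ _ => Subtype.ext (by simp))
  one c := ⟨O.one c, (mem_cocycles rfl).2 (O.d_one c rfl)⟩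
  comp_map h H y z := Subtype.ext (O.comp_map h H _ _)
  comp_sequential H _ _ _ _ _ _ hij hjk hl hr y z t :=
    Subtype.ext (O.comp_sequential H hij hjk hl hr _ _ _)
  comp_parallel H _ _ _ _ _ _ hij hik hl hr y z t :=
    Subtype.ext (O.comp_parallel H hij hik hl hr _ _ _)
  comp_one g σ h1 h2 _ h y := Subtype.ext (O.comp_one g σ h1 h2 h _)
  one_comp g σ h1 _ h y := Subtype.ext (O.one_comp g σ h1 h _)
  d_comp g _ _ _ _ _ _ hi hj hk h hl hr y z := by
    simp
    rfl
  d_one c _ h := rfl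

/-- The ideal of coboundaries in the operad of cocycles. -/
def coboundaries (O : DGOperad.{x, u} Ξ) : O.cocycleOperad.Ideal where
  sub q i := (LinearMap.range (O.d (q := q) (sub_add_cancel i 1))).comap (O.cocycles q i).subtype
  map_mem := by
    rintro q q' i σ ⟨y, hy⟩ ⟨z, hz⟩
    exact ⟨O.map σ z, (O.d_map _ σ z).trans (congrArg (O.map σ) hz)⟩
  d_mem := by
    intro q i j h y hy
    exact Submodule.zero_mem _
  comp_mem_left := by
    rintro r u q i j k g h ⟨y, hy⟩ ⟨z, hz⟩ ⟨t, ht⟩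
    refine ⟨O.comp g (by omega) t z, ?_⟩
    rw [O.d_comp g (sub_add_cancel i 1) rfl _ _ h (by omega), (mem_cocycles rfl).1 hz]
    change O.d _ t = y at ht
    rw [ht]
    simp
    rfl
  comp_mem_right := by
    rintro r u q i j k g h ⟨y, hy⟩ ⟨z, hz⟩ ⟨t, ht⟩
    refine ⟨((-1 : ℚ) ^ i) • O.comp g (by omega) y t, ?_⟩
    rw [map_smul, O.d_comp g rfl (sub_add_cancel j 1) _ _ (by omega) h, (mem_cocycles rfl).1 hy]
    change O.d _ t = z at ht
    rw [ht, map_zero, LinearMap.zero_apply, zero_add, smul_smul, ← mul_zpow]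
    simp
    rfl

/-- The cohomology operad `H(O) = Z(O) / B(O)`, with the zero differential. -/
def cohomology (O : DGOperad.{x, u} Ξ) : DGOperad.{x, u} Ξ :=
  O.cocycleOperad.quotient O.coboundaries

/-- The projection `Z(O) → H(O)`. -/
def toCohomology (O : DGOperad.{x, u} Ξ) {q : Corolla Ξ} {i : ℤ} :
    O.cocycles q i →ₗ[ℚ] O.cohomology.obj q i :=
  (O.coboundaries.sub q i).mkQ

/-- The restriction of a morphism to cocycles. -/
def Hom.cocyclesMap {O : DGOperad.{x, u} Ξ} {Q : DGOperad.{x, v} Ξ} (F : Hom O Q)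
    (q : Corolla Ξ) (i : ℤ) : O.cocycles q i →ₗ[ℚ] Q.cocycles q i :=
  F.app.restrict fun y hy => by
    rw [mem_cocycles rfl] at hy ⊢
    rw [← F.app_d, hy, map_zero]

/-- The map induced on cohomology by a morphism. -/
def Hom.cohomologyMap {O : DGOperad.{x, u} Ξ} {Q : DGOperad.{x, v} Ξ} (F : Hom O Q)
    (q : Corolla Ξ) (i : ℤ) : O.cohomology.obj q i →ₗ[ℚ] Q.cohomology.obj q i :=
  (O.coboundaries.sub q i).mapQ (Q.coboundaries.sub q i) (F.cocyclesMap q i) (by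
    rintro ⟨y, hy⟩ ⟨z, hz⟩
    exact ⟨F.app z, (F.app_d _ z).symm.trans (congrArg F.app hz)⟩)

/-- Quasi-isomorphisms of dg operads. -/
def Hom.IsQuasiIso {O : DGOperad.{x, u} Ξ} {Q : DGOperad.{x, v} Ξ} (F : Hom O Q) : Prop :=
  ∀ (q : Corolla Ξ) (i : ℤ), Function.Bijective (F.cohomologyMap q i)

/-- Membership in the suboperad (of graded vector spaces) generated by a family of sets. -/
inductive Generated (O : DGOperad.{x, u} Ξ) (S : ∀ (q : Corolla Ξ) (i : ℤ), Set (O.obj q i)) :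
    ∀ (q : Corolla Ξ) (i : ℤ), O.obj q i → Prop
  | of {q : Corolla Ξ} {i : ℤ} {y : O.obj q i} (hy : y ∈ S q i) : Generated O S q i y
  | one (c : Ξ) : Generated O S (Corolla.unit c) 0 (O.one c)
  | zero (q : Corolla Ξ) (i : ℤ) : Generated O S q i 0
  | add {q : Corolla Ξ} {i : ℤ} {y z : O.obj q i} (hy : Generated O S q i y)
      (hz : Generated O S q i z) : Generated O S q i (y + z)
  | smul {q : Corolla Ξ} {i : ℤ} (c : ℚ) {y : O.obj q i} (hy : Generated O S q i y) :
      Generated O S q i (c • y)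
  | map {q q' : Corolla Ξ} {i : ℤ} (σ : q.Iso q') {y : O.obj q i} (hy : Generated O S q i y) :
      Generated O S q' i (O.map σ y)
  | comp {r u q : Corolla Ξ} {i j k : ℤ} (g : Graft r u q) (h : i + j = k) {y : O.obj r i}
      {z : O.obj u j} (hy : Generated O S r i y) (hz : Generated O S u j z) :
      Generated O S q k (O.comp g h y z)

end DGOperad


/-! ## The cobar construction -/

section Cobar

variable {Ξ : Type x}

/-- Formal expressions for the elements of the dg operad freely generated by the symbols `s y` of
degree `|y| + 1`, where `y` runs over the homogeneous elements of `P`. -/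
inductive FreeExpr (P : DGPseudoCooperad.{x, v} Ξ) : Corolla Ξ → ℤ → Type (max v x)
  | gen {q : Corolla Ξ} {i j : ℤ} (h : i + 1 = j) (y : P.obj q i) : FreeExpr P q j
  | one (c : Ξ) : FreeExpr P (Corolla.unit c) 0
  | map {q q' : Corolla Ξ} {i : ℤ} (σ : q.Iso q') (e : FreeExpr P q i) : FreeExpr P q' i
  | comp {r u q : Corolla Ξ} {i j k : ℤ} (g : Graft r u q) (h : i + j = k) (e : FreeExpr P r i)
      (f : FreeExpr P u j) : FreeExpr P q k
  | d {q : Corolla Ξ} {i j : ℤ} (h : i + 1 = j) (e : FreeExpr P q i) : FreeExpr P q j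
  | zero (q : Corolla Ξ) (i : ℤ) : FreeExpr P q i
  | add {q : Corolla Ξ} {i : ℤ} (e f : FreeExpr P q i) : FreeExpr P q i
  | smul {q : Corolla Ξ} {i : ℤ} (c : ℚ) (e : FreeExpr P q i) : FreeExpr P q i

open FreeExpr in
/-- The congruence on formal expressions generated by the axioms of a dg operad and by the
requirement that `y ↦ s y` is linear and commutes with the relabellings. -/
inductive FreeRel (P : DGPseudoCooperad.{x, v} Ξ) :
    ∀ {q : Corolla Ξ} {i : ℤ}, FreeExpr P q i → FreeExpr P q i → Prop
  | refl {q : Corolla Ξ} {i : ℤ} (e : FreeExpr P q i) : FreeRel P e e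
  | symm {q : Corolla Ξ} {i : ℤ} {e f : FreeExpr P q i} : FreeRel P e f → FreeRel P f e
  | trans {q : Corolla Ξ} {i : ℤ} {e f g : FreeExpr P q i} :
      FreeRel P e f → FreeRel P f g → FreeRel P e g
  | map_congr {q q' : Corolla Ξ} {i : ℤ} (σ : q.Iso q') {e f : FreeExpr P q i} :
      FreeRel P e f → FreeRel P (map σ e) (map σ f)
  | comp_congr {r u q : Corolla Ξ} {i j k : ℤ} (g : Graft r u q) (h : i + j = k)
      {e e' : FreeExpr P r i} {f f' : FreeExpr P u j} :
      FreeRel P e e' → FreeRel P f f' → FreeRel P (comp g h e f) (comp g h e' f')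
  | d_congr {q : Corolla Ξ} {i j : ℤ} (h : i + 1 = j) {e f : FreeExpr P q i} :
      FreeRel P e f → FreeRel P (d h e) (d h f)
  | add_congr {q : Corolla Ξ} {i : ℤ} {e e' f f' : FreeExpr P q i} :
      FreeRel P e e' → FreeRel P f f' → FreeRel P (add e f) (add e' f')
  | smul_congr {q : Corolla Ξ} {i : ℤ} (c : ℚ) {e f : FreeExpr P q i} :
      FreeRel P e f → FreeRel P (smul c e) (smul c f)
  -- vector spaces
  | add_comm {q : Corolla Ξ} {i : ℤ} (e f : FreeExpr P q i) : FreeRel P (add e f) (add f e)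
  | add_assoc {q : Corolla Ξ} {i : ℤ} (e f g : FreeExpr P q i) :
      FreeRel P (add (add e f) g) (add e (add f g))
  | zero_add {q : Corolla Ξ} {i : ℤ} (e : FreeExpr P q i) : FreeRel P (add (zero q i) e) e
  | smul_add {q : Corolla Ξ} {i : ℤ} (c : ℚ) (e f : FreeExpr P q i) :
      FreeRel P (smul c (add e f)) (add (smul c e) (smul c f))
  | add_smul {q : Corolla Ξ} {i : ℤ} (c c' : ℚ) (e : FreeExpr P q i) :
      FreeRel P (smul (c + c') e) (add (smul c e) (smul c' e))
  | mul_smul {q : Corolla Ξ} {i : ℤ} (c c' : ℚ) (e : FreeExpr P q i) :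
      FreeRel P (smul (c * c') e) (smul c (smul c' e))
  | one_smul {q : Corolla Ξ} {i : ℤ} (e : FreeExpr P q i) : FreeRel P (smul 1 e) e
  | zero_smul {q : Corolla Ξ} {i : ℤ} (e : FreeExpr P q i) : FreeRel P (smul 0 e) (zero q i)
  -- generators
  | gen_add {q : Corolla Ξ} {i j : ℤ} (h : i + 1 = j) (y z : P.obj q i) :
      FreeRel P (gen h (y + z)) (add (gen h y) (gen h z))
  | gen_smul {q : Corolla Ξ} {i j : ℤ} (h : i + 1 = j) (c : ℚ) (y : P.obj q i) :
      FreeRel P (gen h (c • y)) (smul c (gen h y))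
  | gen_map {q q' : Corolla Ξ} {i j : ℤ} (h : i + 1 = j) (σ : q.Iso q') (y : P.obj q i) :
      FreeRel P (gen h (P.map σ y)) (map σ (gen h y))
  -- linearity of the operations
  | map_add {q q' : Corolla Ξ} {i : ℤ} (σ : q.Iso q') (e f : FreeExpr P q i) :
      FreeRel P (map σ (add e f)) (add (map σ e) (map σ f))
  | map_smul {q q' : Corolla Ξ} {i : ℤ} (σ : q.Iso q') (c : ℚ) (e : FreeExpr P q i) :
      FreeRel P (map σ (smul c e)) (smul c (map σ e))
  | d_add {q : Corolla Ξ} {i j : ℤ} (h : i + 1 = j) (e f : FreeExpr P q i) :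
      FreeRel P (d h (add e f)) (add (d h e) (d h f))
  | d_smul {q : Corolla Ξ} {i j : ℤ} (h : i + 1 = j) (c : ℚ) (e : FreeExpr P q i) :
      FreeRel P (d h (smul c e)) (smul c (d h e))
  | comp_add_left {r u q : Corolla Ξ} {i j k : ℤ} (g : Graft r u q) (h : i + j = k)
      (e e' : FreeExpr P r i) (f : FreeExpr P u j) :
      FreeRel P (comp g h (add e e') f) (add (comp g h e f) (comp g h e' f))
  | comp_smul_left {r u q : Corolla Ξ} {i j k : ℤ} (g : Graft r u q) (h : i + j = k) (c : ℚ)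
      (e : FreeExpr P r i) (f : FreeExpr P u j) :
      FreeRel P (comp g h (smul c e) f) (smul c (comp g h e f))
  | comp_add_right {r u q : Corolla Ξ} {i j k : ℤ} (g : Graft r u q) (h : i + j = k)
      (e : FreeExpr P r i) (f f' : FreeExpr P u j) :
      FreeRel P (comp g h e (add f f')) (add (comp g h e f) (comp g h e f'))
  | comp_smul_right {r u q : Corolla Ξ} {i j k : ℤ} (g : Graft r u q) (h : i + j = k) (c : ℚ)
      (e : FreeExpr P r i) (f : FreeExpr P u j) :
      FreeRel P (comp g h e (smul c f)) (smul c (comp g h e f))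
  -- the axioms of a dg operad
  | map_refl {q : Corolla Ξ} {i : ℤ} (e : FreeExpr P q i) :
      FreeRel P (map (Corolla.Iso.refl q) e) e
  | map_trans {q q' q'' : Corolla Ξ} {i : ℤ} (σ : q.Iso q') (τ : q'.Iso q'')
      (e : FreeExpr P q i) : FreeRel P (map (σ.trans τ) e) (map τ (map σ e))
  | d_d {q : Corolla Ξ} {i j k : ℤ} (hi : i + 1 = j) (hj : j + 1 = k) (e : FreeExpr P q i) :
      FreeRel P (d hj (d hi e)) (zero q k)
  | d_map {q q' : Corolla Ξ} {i j : ℤ} (h : i + 1 = j) (σ : q.Iso q') (e : FreeExpr P q i) :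
      FreeRel P (d h (map σ e)) (map σ (d h e))
  | comp_map {r u q r' u' q' : Corolla Ξ} {i j k : ℤ} {σ : r.Iso r'} {τ : u.Iso u'}
      {κ : q.Iso q'} {g : Graft r u q} {g' : Graft r' u' q'} (h : i + j = k)
      (H : Graft.Compat σ τ κ g g') (e : FreeExpr P r i) (f : FreeExpr P u j) :
      FreeRel P (comp g' h (map σ e) (map τ f)) (map κ (comp g h e f))
  | comp_sequential {r u v w m q : Corolla Ξ} {a : Graft r w q} {b : Graft u v w}
      {c : Graft m v q} {c' : Graft r u m} (H : Graft.Sequential a b c c')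
      {i j k ij jk ijk : ℤ} (hij : i + j = ij) (hjk : j + k = jk) (hl : ij + k = ijk)
      (hr : i + jk = ijk) (e : FreeExpr P r i) (f : FreeExpr P u j) (g : FreeExpr P v k) :
      FreeRel P (comp c hl (comp c' hij e f) g) (comp a hr e (comp b hjk f g))
  | comp_parallel {r u v m m' q : Corolla Ξ} {a : Graft r u m} {b : Graft m v q}
      {c : Graft r v m'} {c' : Graft m' u q} (H : Graft.Parallel a b c c')
      {i j k ij ik ijk : ℤ} (hij : i + j = ij) (hik : i + k = ik) (hl : ij + k = ijk)
      (hr : ik + j = ijk) (e : FreeExpr P r i) (f : FreeExpr P u j) (g : FreeExpr P v k) :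
      FreeRel P (comp b hl (comp a hij e f) g)
        (smul ((-1 : ℚ) ^ (j * k)) (comp c' hr (comp c hik e g) f))
  | comp_one {r q : Corolla Ξ} {c : Ξ} (g : Graft r (Corolla.unit c) q) (σ : r.Iso q)
      (h1 : ∀ i k, g.leaf (Sum.inl i) = some k → σ.perm i = k)
      (h2 : ∀ j, g.leaf (Sum.inr j) = some (σ.perm g.leg)) {i : ℤ} (h : i + 0 = i)
      (e : FreeExpr P r i) : FreeRel P (comp g h e (one c)) (map σ e)
  | one_comp {u q : Corolla Ξ} {c : Ξ} (g : Graft (Corolla.unit c) u q) (σ : u.Iso q)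
      (h1 : ∀ j, g.leaf (Sum.inr j) = some (σ.perm j)) {i : ℤ} (h : 0 + i = i)
      (e : FreeExpr P u i) : FreeRel P (comp g h (one c) e) (map σ e)
  | d_comp {r u q : Corolla Ξ} (g : Graft r u q) {i i' j j' k k' : ℤ} (hi : i + 1 = i')
      (hj : j + 1 = j') (hk : k + 1 = k') (h : i + j = k) (hl : i' + j = k') (hr : i + j' = k')
      (e : FreeExpr P r i) (f : FreeExpr P u j) :
      FreeRel P (d hk (comp g h e f))
        (add (comp g hl (d hi e) f) (smul ((-1 : ℚ) ^ i) (comp g hr e (d hj f))))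
  | d_one (c : Ξ) {j : ℤ} (h : 0 + 1 = j) : FreeRel P (d h (one c)) (zero _ j)

/-- The setoid of the congruence `FreeRel`. -/
def freeSetoid (P : DGPseudoCooperad.{x, v} Ξ) (q : Corolla Ξ) (i : ℤ) :
    Setoid (FreeExpr P q i) :=
  ⟨FreeRel P, ⟨FreeRel.refl, FreeRel.symm, FreeRel.trans⟩⟩

/-- The components of the free dg operad. -/
def FreeObj (P : DGPseudoCooperad.{x, v} Ξ) (q : Corolla Ξ) (i : ℤ) : Type (max v x) :=
  Quotient (freeSetoid P q i)

variable (P : DGPseudoCooperad.{x, v} Ξ)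

instance FreeObj.instAdd (q : Corolla Ξ) (i : ℤ) : Add (FreeObj P q i) :=
  ⟨Quotient.map₂ FreeExpr.add fun _ _ h _ _ h' => FreeRel.add_congr h h'⟩

instance FreeObj.instZero (q : Corolla Ξ) (i : ℤ) : Zero (FreeObj P q i) :=
  ⟨Quotient.mk _ (FreeExpr.zero q i)⟩

instance FreeObj.instNeg (q : Corolla Ξ) (i : ℤ) : Neg (FreeObj P q i) :=
  ⟨Quotient.map (FreeExpr.smul (-1)) fun _ _ h => FreeRel.smul_congr _ h⟩

instance FreeObj.instAddCommGroup (q : Corolla Ξ) (i : ℤ) : AddCommGroup (FreeObj P q i) where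
  add_assoc := by
    rintro ⟨e⟩ ⟨f⟩ ⟨g⟩
    exact Quotient.sound (FreeRel.add_assoc e f g)
  add_comm := by
    rintro ⟨e⟩ ⟨f⟩
    exact Quotient.sound (FreeRel.add_comm e f)
  zero_add := by
    rintro ⟨e⟩
    exact Quotient.sound (FreeRel.zero_add e)
  add_zero := by
    rintro ⟨e⟩
    exact Quotient.sound ((FreeRel.add_comm _ _).trans (FreeRel.zero_add e))
  neg_add_cancel := by
    rintro ⟨e⟩
    refine Quotient.sound (((FreeRel.add_congr (FreeRel.refl _) (FreeRel.one_smul e).symm).trans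
      (FreeRel.add_smul (-1) 1 e).symm).trans ?_)
    rw [neg_add_cancel]
    exact FreeRel.zero_smul e
  nsmul := nsmulRec
  zsmul := zsmulRec

instance FreeObj.instModule (q : Corolla Ξ) (i : ℤ) : Module ℚ (FreeObj P q i) where
  smul c := Quotient.map (FreeExpr.smul c) fun _ _ h => FreeRel.smul_congr c h
  one_smul := by
    rintro ⟨e⟩
    exact Quotient.sound (FreeRel.one_smul e)
  mul_smul := by
    rintro c c' ⟨e⟩
    exact Quotient.sound (FreeRel.mul_smul c c' e)
  smul_zero c := by
    refine Quotient.sound ((FreeRel.smul_congr c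
      (FreeRel.zero_smul (FreeExpr.zero q i)).symm).trans ?_)
    refine (FreeRel.mul_smul c 0 (FreeExpr.zero q i)).symm.trans ?_
    rw [mul_zero]
    exact FreeRel.zero_smul _
  smul_add := by
    rintro c ⟨e⟩ ⟨f⟩
    exact Quotient.sound (FreeRel.smul_add c e f)
  add_smul := by
    rintro c c' ⟨e⟩
    exact Quotient.sound (FreeRel.add_smul c c' e)
  zero_smul := by
    rintro ⟨e⟩
    exact Quotient.sound (FreeRel.zero_smul e)

/-- The dg operad freely generated by the symbols `s y` of degree `|y| + 1`, where `y` runs over the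
homogeneous elements of `P` and `s y` depends linearly on `y` and commutes with the relabellings. -/
def freeDGOperad : DGOperad.{x, max v x} Ξ where
  obj := FreeObj P
  map {q q' i} σ :=
    { toFun := Quotient.map (FreeExpr.map σ) fun _ _ h => FreeRel.map_congr σ h
      map_add' := by
        rintro ⟨e⟩ ⟨f⟩
        exact Quotient.sound (FreeRel.map_add σ e f)
      map_smul' := by
        rintro c ⟨e⟩
        exact Quotient.sound (FreeRel.map_smul σ c e) }
  map_refl := by
    rintro q i ⟨e⟩
    exact Quotient.sound (FreeRel.map_refl e)
  map_trans := by
    rintro q q' q'' i σ τ ⟨e⟩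
    exact Quotient.sound (FreeRel.map_trans σ τ e)
  d {q i j} h :=
    { toFun := Quotient.map (FreeExpr.d h) fun _ _ h' => FreeRel.d_congr h h'
      map_add' := by
        rintro ⟨e⟩ ⟨f⟩
        exact Quotient.sound (FreeRel.d_add h e f)
      map_smul' := by
        rintro c ⟨e⟩
        exact Quotient.sound (FreeRel.d_smul h c e) }
  d_d := by
    rintro q i j k hi hj ⟨e⟩
    exact Quotient.sound (FreeRel.d_d hi hj e)
  d_map := by
    rintro q q' i j h σ ⟨e⟩
    exact Quotient.sound (FreeRel.d_map h σ e)
  comp {r u q i j k} g h := LinearMap.mk₂ ℚ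
    (Quotient.map₂ (FreeExpr.comp g h) fun _ _ h1 _ _ h2 => FreeRel.comp_congr g h h1 h2)
    (by
      rintro ⟨e⟩ ⟨e'⟩ ⟨f⟩
      exact Quotient.sound (FreeRel.comp_add_left g h e e' f))
    (by
      rintro c ⟨e⟩ ⟨f⟩
      exact Quotient.sound (FreeRel.comp_smul_left g h c e f))
    (by
      rintro ⟨e⟩ ⟨f⟩ ⟨f'⟩
      exact Quotient.sound (FreeRel.comp_add_right g h e f f'))
    (by
      rintro c ⟨e⟩ ⟨f⟩
      exact Quotient.sound (FreeRel.comp_smul_right g h c e f))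
  one c := Quotient.mk _ (FreeExpr.one c)
  comp_map := by
    rintro r u q r' u' q' i j k σ τ κ g g' h H ⟨e⟩ ⟨f⟩
    exact Quotient.sound (FreeRel.comp_map h H e f)
  comp_sequential := by
    rintro r u v w m q a b c c' H i j k ij jk ijk hij hjk hl hr ⟨e⟩ ⟨f⟩ ⟨g⟩
    exact Quotient.sound (FreeRel.comp_sequential H hij hjk hl hr e f g)
  comp_parallel := by
    rintro r u v m m' q a b c c' H i j k ij ik ijk hij hik hl hr ⟨e⟩ ⟨f⟩ ⟨g⟩
    exact Quotient.sound (FreeRel.comp_parallel H hij hik hl hr e f g)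
  comp_one := by
    rintro r q c g σ h1 h2 i h ⟨e⟩
    exact Quotient.sound (FreeRel.comp_one g σ h1 h2 h e)
  one_comp := by
    rintro u q c g σ h1 i h ⟨e⟩
    exact Quotient.sound (FreeRel.one_comp g σ h1 h e)
  d_comp := by
    rintro r u q g i i' j j' k k' hi hj hk h hl hr ⟨e⟩ ⟨f⟩
    exact Quotient.sound (FreeRel.d_comp g hi hj hk h hl hr e f)
  d_one c j h := Quotient.sound (FreeRel.d_one c h)

/-- The tautological element `y ↦ s y` of degree one. -/
def freeGenerator : Conv P (freeDGOperad P) 1 :=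
  ⟨fun _ _ =>
    { toFun := fun y => Quotient.mk _ (FreeExpr.gen rfl y)
      map_add' := fun y z => Quotient.sound (FreeRel.gen_add rfl y z)
      map_smul' := fun c y => Quotient.sound (FreeRel.gen_smul rfl c y) },
    fun _ _ _ σ y => Quotient.sound (FreeRel.gen_map rfl σ y)⟩

/-- Membership in the dg ideal generated by the elements
`Curv(s)(y) = ∂(s y) + s(∂y) + (s • s)(y)`. -/
inductive CobarIdealMem : ∀ (q : Corolla Ξ) (i : ℤ), (freeDGOperad P).obj q i → Prop
  | curv {q : Corolla Ξ} {i j : ℤ} (h : i + 2 = j) (y : P.obj q i) :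
      CobarIdealMem q j (Conv.app (Conv.curv (freeGenerator P)) h y)
  | zero (q : Corolla Ξ) (i : ℤ) : CobarIdealMem q i 0
  | add {q : Corolla Ξ} {i : ℤ} {e f : (freeDGOperad P).obj q i} (he : CobarIdealMem q i e)
      (hf : CobarIdealMem q i f) : CobarIdealMem q i (e + f)
  | smul {q : Corolla Ξ} {i : ℤ} (c : ℚ) {e : (freeDGOperad P).obj q i}
      (he : CobarIdealMem q i e) : CobarIdealMem q i (c • e)
  | map {q q' : Corolla Ξ} {i : ℤ} (σ : q.Iso q') {e : (freeDGOperad P).obj q i}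
      (he : CobarIdealMem q i e) : CobarIdealMem q' i ((freeDGOperad P).map σ e)
  | d {q : Corolla Ξ} {i j : ℤ} (h : i + 1 = j) {e : (freeDGOperad P).obj q i}
      (he : CobarIdealMem q i e) : CobarIdealMem q j ((freeDGOperad P).d h e)
  | comp_left {r u q : Corolla Ξ} {i j k : ℤ} (g : Graft r u q) (h : i + j = k)
      {e : (freeDGOperad P).obj r i} (f : (freeDGOperad P).obj u j) (he : CobarIdealMem r i e) :
      CobarIdealMem q k ((freeDGOperad P).comp g h e f)
  | comp_right {r u q : Corolla Ξ} {i j k : ℤ} (g : Graft r u q) (h : i + j = k)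
      (e : (freeDGOperad P).obj r i) {f : (freeDGOperad P).obj u j} (hf : CobarIdealMem u j f) :
      CobarIdealMem q k ((freeDGOperad P).comp g h e f)

/-- The dg ideal generated by the elements `∂(s y) + s(∂y) + (s • s)(y)`. -/
def cobarIdeal : (freeDGOperad P).Ideal where
  sub q i :=
    { carrier := {e | CobarIdealMem P q i e}
      add_mem' := fun he hf => CobarIdealMem.add he hf
      zero_mem' := CobarIdealMem.zero q i
      smul_mem' := fun c _ he => CobarIdealMem.smul c he }
  map_mem σ _ he := CobarIdealMem.map σ he
  d_mem h _ he := CobarIdealMem.d h he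
  comp_mem_left g h _ f he := CobarIdealMem.comp_left g h f he
  comp_mem_right g h e _ hf := CobarIdealMem.comp_right g h e hf

/-- The cobar construction `Cobar(P^◇)`: the dg operad generated by the suspension `s P`, whose
differential is prescribed on the generators by
`∂(s y) = - s(∂y) - ∑ (-1)^|y'| s y' ∘_t s y''`, where the sum runs over the isomorphism classes of
labelled trees `t` with two nodal vertices and `Δ_t y = ∑ y' ⊗ y''`. By the axioms of a dg
pseudo-cooperad the derivation of the free graded operad on `s P` with these values squares to zero,
so that this dg operad is the free graded operad on `s P` with that differential. -/
def Cobar : DGOperad.{x, max v x} Ξ := (freeDGOperad P).quotient (cobarIdeal P)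

/-- The tautological element `y ↦ s y` of `Conv(P, Cobar(P^◇))`. -/
def cobarGenerator : Conv P (Cobar P) 1 :=
  ⟨fun q i => ((cobarIdeal P).sub q (i + 1)).mkQ ∘ₗ (freeGenerator P).1 q i,
    fun q q' i σ y => congrArg ((cobarIdeal P).sub q' (i + 1)).mkQ ((freeGenerator P).2 q q' i σ y)⟩

variable {P}

/-- The element `y ↦ ρ(s y)` of `Conv(P, Q)` corresponding to a morphism `ρ : Cobar(P^◇) → Q`. -/
def DGOperad.Hom.toConv {Q : DGOperad.{x, u} Ξ} (ρ : (Cobar P).Hom Q) : Conv P Q 1 :=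
  ⟨fun q i => ρ.app ∘ₗ (cobarGenerator P).1 q i, fun q q' i σ y =>
    (congrArg ρ.app ((cobarGenerator P).2 q q' i σ y)).trans (ρ.app_map σ _)⟩

end Cobar

/-! ## Weight gradings and sprouts -/

section Sprouts

variable {Ξ : Type x}

/-- An additional grading `P = ⨁_{k ≥ 1} G^k P` of a dg pseudo-cooperad by subcollections, such that
`∂(G^{k+1} P) ⊆ G^k P` and `Δ_t(G^n P) ⊆ ⨁_{a + b = n} G^a P ⊗ G^b P` for every tree `t` with two
nodal vertices. -/
structure WeightGrading (P : DGPseudoCooperad.{x, v} Ξ) where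
  part : ℕ → ∀ (q : Corolla Ξ) (i : ℤ), Submodule ℚ (P.obj q i)
  isInternal : ∀ (q : Corolla Ξ) (i : ℤ), DirectSum.IsInternal fun k => part k q i
  part_zero : ∀ (q : Corolla Ξ) (i : ℤ), part 0 q i = ⊥
  map_mem : ∀ {k : ℕ} {q q' : Corolla Ξ} {i : ℤ} (σ : q.Iso q') {y : P.obj q i},
    y ∈ part k q i → P.map σ y ∈ part k q' i
  d_mem : ∀ {k : ℕ} {q : Corolla Ξ} {i j : ℤ} (h : i + 1 = j) {y : P.obj q i},
    y ∈ part (k + 1) q i → P.d h y ∈ part k q j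
  cocomp_mem : ∀ {n : ℕ} {r u q : Corolla Ξ} {i j k : ℤ} (g : Graft r u q) (h : i + j = k)
    {y : P.obj q k}, y ∈ part n q k →
    P.cocomp g h y ∈ ⨆ p ∈ Finset.HasAntidiagonal.antidiagonal n,
      LinearMap.range (TensorProduct.map (part p.1 r i).subtype (part p.2 u j).subtype)

/-- The ascending filtration `F^m P = ⨁_{k ≤ m} G^k P`. -/
def WeightGrading.filtration {P : DGPseudoCooperad.{x, v} Ξ} (G : WeightGrading P) (m : ℕ)
    (q : Corolla Ξ) (i : ℤ) : Submodule ℚ (P.obj q i) :=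
  ⨆ k ∈ Set.Iic m, G.part k q i

/-- Every `G^k P` is finite dimensional (in total, over all corollas and degrees). -/
def WeightGrading.FiniteParts {P : DGPseudoCooperad.{x, v} Ξ} (G : WeightGrading P) : Prop :=
  ∀ k : ℕ, (∀ (q : Corolla Ξ) (i : ℤ), Module.Finite ℚ (G.part k q i)) ∧
    {p : Corolla Ξ × ℤ | G.part k p.1 p.2 ≠ ⊥}.Finite

/-- The descending filtration on `Conv(P, O)`: the space `F_{m+1} Conv(P, O)` of the elements
vanishing on `F^m P`. -/
def Conv.filtrationSucc {P : DGPseudoCooperad.{x, v} Ξ} {O : DGOperad.{x, u} Ξ}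
    (G : WeightGrading P) (m : ℕ) (a : ℤ) : Set (Conv P O a) :=
  {f | ∀ (q : Corolla Ξ) (i j : ℤ) (h : i + a = j), ∀ y ∈ G.filtration m q i, Conv.app f h y = 0}

/-- An `n`-th MC-sprout: a degree one element `α` with `Curv(α) ∈ F_{n+1} Conv(P, O)`. -/
def IsMCSprout {P : DGPseudoCooperad.{x, v} Ξ} {O : DGOperad.{x, u} Ξ} (G : WeightGrading P)
    (n : ℕ) (α : Conv P O 1) : Prop :=
  Conv.curv α ∈ Conv.filtrationSucc G n 2

end Sprouts

/-!
Over `ℚ`, averaging over the finite groups of relabellings turns linear sections into equivariant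
ones. Hence `α_H` lifts along the surjections `Z(O) → H(O) ≅ H` to a cocycle valued element `β`,
whose curvature is exact on `F² P`, because its cohomology class is `Curv(α_H) = 0` there.

Since `G⁰ P = 0`, the differential and the comultiplications of `P` take `F^{m+1} P` to `F^m P`
and `F^m P ⊗ F^m P`. So, on `F^{m+1} P`, changing an element of degree one outside of `F^m P`
changes its curvature only through the term `∂_O ∘ f`. For `m = 0` this shows that the curvature
of `β` vanishes on `F¹ P`; for `m = 1` it shows that subtracting from `β` an equivariant primitive
of `Curv(β)` kills the curvature on `F² P`. The primitive vanishes where `Curv(β)` does, so `β` is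
unchanged on `F¹ P`.
-/

/-! ## Averaging over relabellings -/

theorem exists_linear_pseudoinverse {K V W : Type*} [DivisionRing K] [AddCommGroup V] [Module K V]
    [AddCommGroup W] [Module K W] (f : V →ₗ[K] W) : ∃ s : W →ₗ[K] V, ∀ y, f (s (f y)) = f y := by
  obtain ⟨r, hr⟩ := f.rangeRestrict.exists_rightInverse_of_surjective f.range_rangeRestrict
  obtain ⟨s, hs⟩ := r.exists_extend
  refine ⟨s, fun y => ?_⟩
  have hsr : s (f y) = r (f.rangeRestrict y) := LinearMap.congr_fun hs (f.rangeRestrict y)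
  rw [hsr]
  exact congrArg Subtype.val (LinearMap.congr_fun hr (f.rangeRestrict y))

namespace Corolla

variable {Ξ : Type x} {p q q' : Corolla Ξ}

attribute [ext] Iso

theorem Iso.trans_symm_self (σ : q.Iso q') : σ.trans σ.symm = Iso.refl q :=
  Iso.ext σ.perm.self_trans_symm

noncomputable instance Iso.instFintype : Fintype (q.Iso q') :=
  Fintype.ofInjective Iso.perm fun _ _ => Iso.ext

/-- Postcomposition with a relabelling, as a bijection between sets of relabellings. -/
def Iso.transEquiv (p : Corolla Ξ) (κ : q.Iso q') : p.Iso q ≃ p.Iso q' where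
  toFun σ := σ.trans κ
  invFun σ := σ.trans κ.symm
  left_inv σ := Iso.ext (by ext; simp [Iso.trans, Iso.symm])
  right_inv σ := Iso.ext (by ext; simp [Iso.trans, Iso.symm])

/-- The equivalence relation of being isomorphic on the class of corollas. -/
def isoSetoid (Ξ : Type x) : Setoid (Corolla Ξ) where
  r q q' := Nonempty (q.Iso q')
  iseqv := ⟨fun q => ⟨Iso.refl q⟩, fun ⟨σ⟩ => ⟨σ.symm⟩, fun ⟨σ⟩ ⟨τ⟩ => ⟨σ.trans τ⟩⟩

/-- A chosen representative of the isomorphism class of a corolla; isomorphic corollas have equal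
representatives. -/
noncomputable def rep (q : Corolla Ξ) : Corolla Ξ := (Quotient.mk (isoSetoid Ξ) q).out

theorem Iso.rep_eq (σ : q.Iso q') : q.rep = q'.rep :=
  congrArg Quotient.out (Quotient.sound (s := isoSetoid Ξ) ⟨σ⟩)

theorem nonempty_rep_iso (q : Corolla Ξ) : Nonempty (q.rep.Iso q) :=
  Quotient.exact (s := isoSetoid Ξ) (Quotient.out_eq _)

end Corolla

namespace DGCollection

variable {Ξ : Type x} {A : DGCollection.{x, u} Ξ} {B : DGCollection.{x, v} Ξ} {i j : ℤ}

theorem map_symm_map {q q' : Corolla Ξ} (σ : q.Iso q') (y : A.obj q i) :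
    A.map σ.symm (A.map σ y) = y := by
  rw [← A.map_trans, σ.trans_symm_self, A.map_refl]

theorem map_map_symm {q q' : Corolla Ξ} (σ : q.Iso q') (y : A.obj q' i) :
    A.map σ (A.map σ.symm y) = y :=
  map_symm_map σ.symm y

/-- A family of linear maps between homogeneous components of two collections is equivariant if it
commutes with all relabellings. -/
def IsEquivariant (f : ∀ q : Corolla Ξ, A.obj q i →ₗ[ℚ] B.obj q j) : Prop :=
  ∀ ⦃q q' : Corolla Ξ⦄ (σ : q.Iso q') (y : A.obj q i), f q' (A.map σ y) = B.map σ (f q y)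

/-- The average of the conjugates of `s` by the relabellings of a corolla. Only the values of `s` at
the chosen representatives matter, so that the averages at isomorphic corollas are related by every
relabelling and not only by the automorphisms of one corolla. -/
noncomputable def average (s : ∀ q : Corolla Ξ, A.obj q i →ₗ[ℚ] B.obj q j) (q : Corolla Ξ) :
    A.obj q i →ₗ[ℚ] B.obj q j :=
  (Fintype.card (q.rep.Iso q) : ℚ)⁻¹ • ∑ σ : q.rep.Iso q, B.map σ ∘ₗ s q.rep ∘ₗ A.map σ.symm

theorem average_apply (s : ∀ q : Corolla Ξ, A.obj q i →ₗ[ℚ] B.obj q j) (q : Corolla Ξ)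
    (y : A.obj q i) : average s q y = (Fintype.card (q.rep.Iso q) : ℚ)⁻¹ •
      ∑ σ : q.rep.Iso q, B.map σ (s q.rep (A.map σ.symm y)) := by
  simp [average, LinearMap.sum_apply]

theorem isEquivariant_average (s : ∀ q : Corolla Ξ, A.obj q i →ₗ[ℚ] B.obj q j) :
    IsEquivariant (average s) := by
  intro q q' κ y
  rw [average_apply, average_apply, ← κ.rep_eq, map_smul, map_sum,
    ← Fintype.card_congr (Corolla.Iso.transEquiv q.rep κ),
    ← (Corolla.Iso.transEquiv q.rep κ).sum_comp]
  congr 1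
  refine Finset.sum_congr rfl fun σ _ => ?_
  have hsymm : (σ.trans κ).symm = κ.symm.trans σ.symm := rfl
  change B.map (σ.trans κ) (s _ (A.map (σ.trans κ).symm _)) = _
  rw [hsymm, A.map_trans, A.map_symm_map, B.map_trans]

theorem IsEquivariant.apply_average {f : ∀ q : Corolla Ξ, A.obj q i →ₗ[ℚ] B.obj q j}
    (hf : IsEquivariant f) {s : ∀ q : Corolla Ξ, B.obj q j →ₗ[ℚ] A.obj q i}
    (hs : ∀ q y, f q (s q (f q y)) = f q y) (q : Corolla Ξ) (y : A.obj q i) :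
    f q (average s q (f q y)) = f q y := by
  have hterm (σ : q.rep.Iso q) : f q (A.map σ (s q.rep (B.map σ.symm (f q y)))) = f q y := by
    rw [← hf, hf σ, hs, ← hf, map_map_symm]
  have : Nonempty (q.rep.Iso q) := q.nonempty_rep_iso
  have hcard : (Fintype.card (q.rep.Iso q) : ℚ) ≠ 0 := Nat.cast_ne_zero.2 Fintype.card_ne_zero
  simp only [average_apply, map_smul, map_sum, hterm, Finset.sum_const, Finset.card_univ,
    ← Nat.cast_smul_eq_nsmul ℚ]
  exact inv_smul_smul₀ hcard _

theorem IsEquivariant.exists_pseudoinverse {f : ∀ q : Corolla Ξ, A.obj q i →ₗ[ℚ] B.obj q j}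
    (hf : IsEquivariant f) : ∃ s : ∀ q : Corolla Ξ, B.obj q j →ₗ[ℚ] A.obj q i,
      IsEquivariant s ∧ ∀ q y, f q (s q (f q y)) = f q y := by
  choose s hs using fun q => exists_linear_pseudoinverse (f q)
  exact ⟨average s, isEquivariant_average s, hf.apply_average hs⟩

end DGCollection

/-! ## Functoriality of the convolution Lie algebra -/

namespace DGOperad

variable {Ξ : Type x}

/-- The inclusion `Z(O) → O` of the operad of cocycles. -/
def cocyclesIncl (O : DGOperad.{x, u} Ξ) : O.cocycleOperad.Hom O where
  app {q i} := (O.cocycles q i).subtype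
  app_map _ _ := rfl
  app_d h y := ((mem_cocycles h).1 y.2).symm
  app_one _ := rfl
  app_comp _ _ _ _ := rfl

/-- The projection of a dg operad to its quotient by a dg ideal. -/
def quotientHom (O : DGOperad.{x, u} Ξ) (I : O.Ideal) : O.Hom (O.quotient I) where
  app {q i} := (I.sub q i).mkQ
  app_map _ _ := rfl
  app_d _ _ := rfl
  app_one _ := rfl
  app_comp _ _ _ _ := rfl

/-- The projection `Z(O) → H(O)` as a morphism of dg operads; its components are `toCohomology`. -/
def cohomologyProj (O : DGOperad.{x, u} Ξ) : O.cocycleOperad.Hom O.cohomology :=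
  O.cocycleOperad.quotientHom O.coboundaries

theorem toCohomology_eq_zero_iff {O : DGOperad.{x, u} Ξ} {q : Corolla Ξ} {i j : ℤ} (h : i + 1 = j)
    (y : O.cocycles q j) : O.toCohomology y = 0 ↔ y.1 ∈ LinearMap.range (O.d (q := q) h) := by
  obtain rfl : i = j - 1 := by omega
  exact Submodule.Quotient.mk_eq_zero _

end DGOperad

namespace Conv

variable {Ξ : Type x} {P : DGPseudoCooperad.{x, v} Ξ} {O : DGOperad.{x, u} Ξ}
  {Q : DGOperad.{x, w} Ξ} {a b c : ℤ}

theorem ext_apply {f g : Conv P O a} (h : ∀ q i y, f.1 q i y = g.1 q i y) : f = g :=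
  Subtype.ext (funext fun q => funext fun i => LinearMap.ext (h q i))

/-- The composition of an element of `Conv(P, O)` with an equivariant family of linear maps
`O → Q`, which need not be compatible with the differentials or the compositions. -/
def postcomp (s : ∀ (i : ℤ) (q : Corolla Ξ), O.obj q (i + a) →ₗ[ℚ] Q.obj q (i + b))
    (hs : ∀ i, DGCollection.IsEquivariant (A := O.toDGCollection) (B := Q.toDGCollection) (s i))
    (f : Conv P O a) : Conv P Q b :=
  ⟨fun q i => s i q ∘ₗ f.1 q i, fun q q' i σ y =>
    (congrArg (s i q') (f.2 q q' i σ y)).trans (hs i σ _)⟩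

/-- The map `Conv(P, O) → Conv(P, Q)` induced by a morphism of dg operads `O → Q`. -/
def push (F : O.Hom Q) (f : Conv P O a) : Conv P Q a :=
  postcomp (fun _ _ => F.app) (fun _ _ _ => F.app_map) f

theorem app_push (F : O.Hom Q) (f : Conv P O a) {q : Corolla Ξ} {i j : ℤ} (h : i + a = j)
    (y : P.obj q i) : app (push F f) h y = F.app (app f h y) := by
  subst h
  rfl

theorem push_zero (F : O.Hom Q) : push F (0 : Conv P O a) = 0 :=
  ext_apply fun _ _ _ => map_zero F.app

theorem exists_push_eq (F : O.Hom Q)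
    (hF : ∀ q i, Function.Surjective (F.app : O.obj q i →ₗ[ℚ] Q.obj q i)) (f : Conv P Q a) :
    ∃ g : Conv P O a, push F g = f := by
  choose s hs hFs using fun i : ℤ => DGCollection.IsEquivariant.exists_pseudoinverse
    (A := O.toDGCollection) (B := Q.toDGCollection) (i := i + a) (f := fun _ => F.app)
    fun _ _ => F.app_map
  refine ⟨postcomp s hs f, ext_apply fun q i y => ?_⟩
  obtain ⟨z, hz⟩ := hF q (i + a) (f.1 q i y)
  change F.app (s i q (f.1 q i y)) = f.1 q i y
  rw [← hz, hFs]

theorem exists_primitive (h : a + 1 = b) (f : Conv P O b) :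
    ∃ g : Conv P O a, ∀ (q : Corolla Ξ) (i : ℤ) (y : P.obj q i), (f.1 q i y = 0 → g.1 q i y = 0) ∧
      (f.1 q i y ∈ LinearMap.range (O.d (q := q) (show (i + a) + 1 = i + b by omega)) →
        O.d (show (i + a) + 1 = i + b by omega) (g.1 q i y) = f.1 q i y) := by
  choose s hs hds using fun i : ℤ => DGCollection.IsEquivariant.exists_pseudoinverse
    (A := O.toDGCollection) (B := O.toDGCollection)
    (f := fun _ => O.d (show (i + a) + 1 = i + b by omega)) fun _ _ σ y => O.d_map _ σ y
  refine ⟨postcomp s hs f, fun q i y => ⟨fun hy => ?_, fun ⟨z, hz⟩ => ?_⟩⟩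
  · exact (congrArg (s i q) hy).trans (map_zero _)
  · change O.d _ (s i q (f.1 q i y)) = f.1 q i y
    rw [← hz, hds]

theorem preLie_apply (hc : a + b = c) (f : Conv P O a) (g : Conv P O b) {q : Corolla Ξ} {k : ℤ}
    (y : P.obj q k) : (preLie hc f g).1 q k y =
      ∑ᶠ p : TwoTree.Class q × ℤ, preLieTerm hc f g p.1.out p.2 rfl y :=
  rfl

theorem preLie_zero_left (hc : a + b = c) (g : Conv P O b) : preLie hc (0 : Conv P O a) g = 0 := by
  refine ext_apply fun q k y => (finsum_congr fun p => ?_).trans finsum_zero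
  have hzero : app (0 : Conv P O a) (rfl : p.2 + a = p.2 + a) =
      (0 : P.obj p.1.out.lower p.2 →ₗ[ℚ] _) := rfl
  simp [preLieTerm, hzero, TensorProduct.map_zero_left]

theorem curv_apply (f : Conv P O 1) {q : Corolla Ξ} {i : ℤ} (y : P.obj q i) :
    (curv f).1 q i y = O.d (show (i + 1) + 1 = i + 2 by omega) (f.1 q i y) +
      app f (show (i + 1) + 1 = i + 2 by omega) (P.d rfl y) +
      (preLie (show (1 : ℤ) + 1 = 2 by norm_num) f f).1 q i y := by
  have hbracket : bracket (show (1 : ℤ) + 1 = 2 by norm_num) f f =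
      (2 : ℚ) • preLie (show (1 : ℤ) + 1 = 2 by norm_num) f f := by
    rw [bracket, mul_one, zpow_one]
    module
  rw [curv, hbracket, smul_smul, one_div_mul_cancel two_ne_zero, one_smul]
  change (O.d _ (f.1 q i y) - ((-1 : ℚ) ^ (1 : ℤ)) • app f _ (P.d rfl y)) + _ = _
  rw [zpow_one]
  module

theorem curv_zero : curv (0 : Conv P O 1) = 0 := by
  refine ext_apply fun q i y => ?_
  have happ {j : ℤ} (h : (i + 1) + 1 = j) : app (0 : Conv P O 1) h (P.d rfl y) = 0 := by
    subst h
    rfl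
  rw [curv_apply, happ, preLie_zero_left, add_zero]
  exact (add_zero _).trans (map_zero _)

theorem preLieTerm_push (F : O.Hom Q) (hc : a + b = c) (f : Conv P O a) (g : Conv P O b)
    {q : Corolla Ξ} (t : TwoTree q) (i : ℤ) {k l : ℤ} (h : k + c = l) (y : P.obj q k) :
    preLieTerm hc (push F f) (push F g) t i h y = F.app (preLieTerm hc f g t i h y) := by
  simp only [preLieTerm, LinearMap.smul_apply, LinearMap.comp_apply, map_smul]
  congr 1
  induction P.cocomp t.graft (add_sub_cancel i k) y using TensorProduct.induction_on with
  | zero => simp only [map_zero]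
  | tmul y z => simp only [TensorProduct.map_tmul, TensorProduct.lift.tmul, app_push, F.app_comp]
  | add y z hy hz => simp only [map_add, hy, hz]

theorem preLie_push (F : O.Hom Q) (hc : a + b = c) (f : Conv P O a) (g : Conv P O b) :
    preLie hc (push F f) (push F g) = push F (preLie hc f g) := by
  refine ext_apply fun q k y => ?_
  rw [preLie_apply]
  simp only [preLieTerm_push]
  exact (F.app.toAddMonoidHom.map_finsum (finite_support_preLieTerm hc f g rfl y)).symm

theorem curv_push (F : O.Hom Q) (f : Conv P O 1) : curv (push F f) = push F (curv f) := by
  refine ext_apply fun q i y => ?_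
  change _ = F.app ((curv f).1 q i y)
  rw [curv_apply, curv_apply, map_add, map_add, F.app_d, app_push, preLie_push]
  rfl

theorem curv_push_cocyclesIncl_mem_range (f : Conv P O.cocycleOperad 1) {q : Corolla Ξ} {i : ℤ}
    {y : P.obj q i} (hy : (curv (push O.cohomologyProj f)).1 q i y = 0) :
    (curv (push O.cocyclesIncl f)).1 q i y ∈
      LinearMap.range (O.d (q := q) (show (i + 1) + 1 = i + 2 by omega)) := by
  rw [curv_push] at hy ⊢
  exact (DGOperad.toCohomology_eq_zero_iff _ ((curv f).1 q i y)).1 hy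

end Conv

theorem curv_cobarGenerator {Ξ : Type x} (P : DGPseudoCooperad.{x, v} Ξ) :
    Conv.curv (cobarGenerator P) = 0 := by
  have hcurv := Conv.curv_push ((freeDGOperad P).quotientHom (cobarIdeal P)) (freeGenerator P)
  refine hcurv.trans (Conv.ext_apply fun q i y => ?_)
  exact (Submodule.Quotient.mk_eq_zero _).2 (CobarIdealMem.curv rfl y)

theorem DGOperad.Hom.curv_toConv {Ξ : Type x} {P : DGPseudoCooperad.{x, v} Ξ}
    {Q : DGOperad.{x, u} Ξ} (ρ : (Cobar P).Hom Q) : Conv.curv ρ.toConv = 0 := by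
  refine (Conv.curv_push ρ (cobarGenerator P)).trans ?_
  rw [curv_cobarGenerator, Conv.push_zero]

/-! ## Obstruction theory of sprouts -/

namespace WeightGrading

variable {Ξ : Type x} {P : DGPseudoCooperad.{x, v} Ξ} (G : WeightGrading P) {m : ℕ}
  {q : Corolla Ξ} {i : ℤ}

theorem subtype_part_zero (q : Corolla Ξ) (i : ℤ) : (G.part 0 q i).subtype = 0 :=
  LinearMap.ext fun y => (Submodule.mem_bot ℚ).1 (G.part_zero q i ▸ y.2)

theorem part_le_filtration {k : ℕ} (hk : k ≤ m) (q : Corolla Ξ) (i : ℤ) :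
    G.part k q i ≤ G.filtration m q i :=
  le_iSup₂_of_le k hk le_rfl

theorem filtration_le_iff {S : Submodule ℚ (P.obj q i)} :
    G.filtration (m + 1) q i ≤ S ↔ ∀ k ≤ m, G.part (k + 1) q i ≤ S := by
  refine iSup₂_le_iff.trans ⟨fun h k hk => h (k + 1) (Nat.succ_le_succ hk), fun h k hk => ?_⟩
  cases k with
  | zero => exact (G.part_zero q i).le.trans bot_le
  | succ k => exact h k (Nat.le_of_succ_le_succ hk)

theorem filtration_zero (q : Corolla Ξ) (i : ℤ) : G.filtration 0 q i = ⊥ :=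
  le_bot_iff.1 (iSup₂_le fun _ hk => by rw [Nat.le_zero.1 hk, G.part_zero])

theorem d_mem_filtration {j : ℤ} (h : i + 1 = j) {y : P.obj q i}
    (hy : y ∈ G.filtration (m + 1) q i) : P.d h y ∈ G.filtration m q j := by
  suffices G.filtration (m + 1) q i ≤ (G.filtration m q j).comap (P.d h) from this hy
  exact G.filtration_le_iff.2 fun k hk _ hz => G.part_le_filtration hk q j (G.d_mem h hz)

theorem cocomp_mem_filtration {r u : Corolla Ξ} {j k : ℤ} (g : Graft r u q) (h : i + j = k)
    {y : P.obj q k} (hy : y ∈ G.filtration (m + 1) q k) :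
    P.cocomp g h y ∈ LinearMap.range
      (TensorProduct.mapIncl (G.filtration m r i) (G.filtration m u j)) := by
  suffices G.filtration (m + 1) q k ≤ (LinearMap.range
    (TensorProduct.mapIncl (G.filtration m r i) (G.filtration m u j))).comap (P.cocomp g h) from
      this hy
  refine G.filtration_le_iff.2 fun n hn z hz =>
    (iSup₂_le fun p hp => ?_ : _ ≤ LinearMap.range _) (G.cocomp_mem g h hz)
  have hsum : p.1 + p.2 = n + 1 := Finset.HasAntidiagonal.mem_antidiagonal.1 hp
  obtain hp1 | hp2 | ⟨hp1, hp2⟩ : p.1 = 0 ∨ p.2 = 0 ∨ (p.1 ≤ m ∧ p.2 ≤ m) := by omega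
  · rw [hp1, G.subtype_part_zero, TensorProduct.map_zero_left, LinearMap.range_zero]
    exact bot_le
  · rw [hp2, G.subtype_part_zero, TensorProduct.map_zero_right, LinearMap.range_zero]
    exact bot_le
  · exact TensorProduct.range_mapIncl_mono (G.part_le_filtration hp1 r i)
      (G.part_le_filtration hp2 u j)

end WeightGrading

namespace Conv

variable {Ξ : Type x} {P : DGPseudoCooperad.{x, v} Ξ} {O : DGOperad.{x, u} Ξ}
  {Q : DGOperad.{x, w} Ξ} {G : WeightGrading P} {m : ℕ} {a b c : ℤ}

theorem mem_filtrationSucc {f : Conv P O a} : f ∈ filtrationSucc G m a ↔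
    ∀ (q : Corolla Ξ) (i : ℤ), ∀ y ∈ G.filtration m q i, f.1 q i y = 0 :=
  ⟨fun hf q i y hy => hf q i _ rfl y hy, by rintro hf q i _ rfl y hy; exact hf q i y hy⟩

theorem mem_filtrationSucc_zero (G : WeightGrading P) (f : Conv P O a) :
    f ∈ filtrationSucc G 0 a :=
  mem_filtrationSucc.2 fun q i y hy => by
    rw [G.filtration_zero, Submodule.mem_bot] at hy
    rw [hy, map_zero]

theorem app_eq_of_sub_mem_filtrationSucc {f f' : Conv P O a} (hf : f - f' ∈ filtrationSucc G m a)
    {q : Corolla Ξ} {i j : ℤ} (h : i + a = j) {y : P.obj q i} (hy : y ∈ G.filtration m q i) :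
    app f h y = app f' h y := by
  subst h
  exact sub_eq_zero.1 (mem_filtrationSucc.1 hf q i y hy)

theorem preLie_apply_congr (hc : a + b = c) {f f' : Conv P O a} {g g' : Conv P O b}
    (hf : f - f' ∈ filtrationSucc G m a) (hg : g - g' ∈ filtrationSucc G m b)
    {q : Corolla Ξ} {k : ℤ} {y : P.obj q k} (hy : y ∈ G.filtration (m + 1) q k) :
    (preLie hc f g).1 q k y = (preLie hc f' g').1 q k y := by
  refine finsum_congr fun p => ?_
  obtain ⟨t, ht⟩ := G.cocomp_mem_filtration p.1.out.graft (add_sub_cancel p.2 k) hy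
  have hmaps : TensorProduct.map (app f rfl) (app g rfl) ∘ₗ TensorProduct.mapIncl _ _ =
      TensorProduct.map (app f' rfl) (app g' rfl) ∘ₗ TensorProduct.mapIncl
        (G.filtration m p.1.out.lower p.2) (G.filtration m p.1.out.upper (k - p.2)) :=
    TensorProduct.ext' fun y z => congrArg₂ (· ⊗ₜ[ℚ] ·)
      (app_eq_of_sub_mem_filtrationSucc hf rfl y.2) (app_eq_of_sub_mem_filtrationSucc hg rfl z.2)
  simp only [preLieTerm, LinearMap.smul_apply, LinearMap.comp_apply, ← ht]
  exact congrArg _ (congrArg _ (LinearMap.congr_fun hmaps t))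

theorem curv_sub_curv_apply {f f' : Conv P O 1} (hf : f - f' ∈ filtrationSucc G m 1)
    {q : Corolla Ξ} {i : ℤ} {y : P.obj q i} (hy : y ∈ G.filtration (m + 1) q i) :
    (curv f).1 q i y - (curv f').1 q i y =
      O.d (show (i + 1) + 1 = i + 2 by omega) (f.1 q i y - f'.1 q i y) := by
  rw [curv_apply, curv_apply, preLie_apply_congr _ hf hf hy,
    app_eq_of_sub_mem_filtrationSucc hf _ (G.d_mem_filtration rfl hy), map_sub]
  abel

theorem curv_apply_of_mem_filtration_one (f : Conv P O 1) {q : Corolla Ξ} {i : ℤ} {y : P.obj q i}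
    (hy : y ∈ G.filtration 1 q i) :
    (curv f).1 q i y = O.d (show (i + 1) + 1 = i + 2 by omega) (f.1 q i y) := by
  have hsub := curv_sub_curv_apply (mem_filtrationSucc_zero G (f - 0)) hy
  rw [curv_zero] at hsub
  simpa using hsub

theorem isMCSprout_one_push_cocyclesIncl (G : WeightGrading P) (f : Conv P O.cocycleOperad 1) :
    IsMCSprout G 1 (push O.cocyclesIncl f) :=
  mem_filtrationSucc.2 fun q i y hy =>
    (curv_apply_of_mem_filtration_one _ hy).trans ((DGOperad.mem_cocycles _).1 (f.1 q i y).2)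

theorem isMCSprout_of_push {F : O.Hom Q}
    (hF : ∀ q i, Function.Injective (F.app : O.obj q i →ₗ[ℚ] Q.obj q i)) {f : Conv P O 1}
    (hf : IsMCSprout G m (push F f)) : IsMCSprout G m f := by
  rw [IsMCSprout, curv_push] at hf
  exact mem_filtrationSucc.2 fun q i y hy =>
    hF q (i + 2) ((mem_filtrationSucc.1 hf q i y hy).trans (map_zero F.app).symm)

theorem isMCSprout_toConv (G : WeightGrading P) (m : ℕ) (ρ : (Cobar P).Hom O) :
    IsMCSprout G m ρ.toConv :=
  mem_filtrationSucc.2 fun _ _ _ _ => by rw [ρ.curv_toConv]; rfl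

theorem exists_isMCSprout_succ {f : Conv P O 1} (hf : IsMCSprout G m f)
    (hexact : ∀ (q : Corolla Ξ) (i : ℤ), ∀ y ∈ G.filtration (m + 1) q i, (curv f).1 q i y ∈
      LinearMap.range (O.d (q := q) (show (i + 1) + 1 = i + 2 by omega))) :
    ∃ α : Conv P O 1, IsMCSprout G (m + 1) α ∧ α - f ∈ filtrationSucc G m 1 := by
  obtain ⟨g, hg⟩ := exists_primitive (show (1 : ℤ) + 1 = 2 by norm_num) (curv f)
  have hsub : (f - g) - f ∈ filtrationSucc G m 1 := by
    rw [sub_sub_cancel_left]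
    exact mem_filtrationSucc.2 fun q i y hy =>
      neg_eq_zero.2 ((hg q i y).1 (mem_filtrationSucc.1 hf q i y hy))
  refine ⟨f - g, mem_filtrationSucc.2 fun q i y hy => ?_, hsub⟩
  have hdg := (hg q i y).2 (hexact q i y hy)
  have hcurv := curv_sub_curv_apply hsub hy
  change _ = O.d _ ((f.1 q i y - g.1 q i y) - f.1 q i y) at hcurv
  rw [sub_sub_cancel_left, map_neg, hdg] at hcurv
  exact sub_eq_neg_self.1 hcurv

end Conv

theorem mainTheorem8_general {Ξ : Type x} (P : DGPseudoCooperad.{x, v} Ξ) (O : DGOperad.{x, u} Ξ)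
    (H : DGOperad.{x, w} Ξ) (φ : O.cohomology.Hom H) (hφ : φ.IsIso) (G : WeightGrading P)
    (γ : Conv P H 1) (hγ : IsMCSprout G 2 γ) :
    ∃ α : Conv P O 1, IsMCSprout G 2 α ∧
      ∀ (q : Corolla Ξ) (i j : ℤ) (h : i + 1 = j), ∀ y ∈ G.part 1 q i,
        ∃ hy : Conv.app α h y ∈ O.cocycles q j,
          φ.app (O.toCohomology ⟨Conv.app α h y, hy⟩) = Conv.app γ h y := by
  obtain ⟨θ, rfl⟩ := Conv.exists_push_eq φ (fun q i => (hφ q i).2) γ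
  obtain ⟨ζ, rfl⟩ := Conv.exists_push_eq O.cohomologyProj (fun _ _ => Submodule.mkQ_surjective _) θ
  have hcoh : IsMCSprout G 2 (Conv.push O.cohomologyProj ζ) :=
    Conv.isMCSprout_of_push (fun q i => (hφ q i).1) hγ
  obtain ⟨α, hα, hαζ⟩ := Conv.exists_isMCSprout_succ (Conv.isMCSprout_one_push_cocyclesIncl G ζ)
    fun q i y hy =>
      Conv.curv_push_cocyclesIncl_mem_range ζ (Conv.mem_filtrationSucc.1 hcoh q i y hy)
  refine ⟨α, hα, ?_⟩
  rintro q i _ rfl y hy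
  have hy' : y ∈ G.filtration 1 q i := G.part_le_filtration le_rfl q i hy
  have hαy : Conv.app α rfl y = (ζ.1 q i y).1 :=
    Conv.app_eq_of_sub_mem_filtrationSucc hαζ rfl hy'
  refine ⟨hαy ▸ (ζ.1 q i y).2, ?_⟩
  exact congrArg (fun z => φ.app (O.toCohomology z)) (Subtype.ext hαy)

theorem mainTheorem8 {Ξ : Type x}
    (P : DGPseudoCooperad.{x, v} Ξ) (O : DGOperad.{x, u} Ξ) (H : DGOperad.{x, w} Ξ)
    (φ : O.cohomology.Hom H) (hφ : φ.IsIso)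
    (ρ : (Cobar P).Hom H) (hρ : ρ.IsQuasiIso)
    (G : WeightGrading P) (hG : G.FiniteParts)
    (hO : ∀ (q : Corolla Ξ) (i : ℤ), Module.Finite ℚ (O.obj q i))
    (hgen : ∀ (q : Corolla Ξ) (i : ℤ) (y : H.obj q i),
      H.Generated (fun q j => {z | ∃ (i : ℤ) (h : i + 1 = j), ∃ t ∈ G.part 1 q i,
        Conv.app ρ.toConv h t = z}) q i y)
    (hvan : ∀ k : ℕ, 2 ≤ k → ∀ (q : Corolla Ξ) (i j : ℤ) (h : i + 1 = j), ∀ y ∈ G.part k q i,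
      Conv.app ρ.toConv h y = 0) :
    ∃ α : Conv P O 1, IsMCSprout G 2 α ∧
      ∀ (q : Corolla Ξ) (i j : ℤ) (h : i + 1 = j), ∀ y ∈ G.part 1 q i,
        ∃ hy : Conv.app α h y ∈ O.cocycles q j,
          φ.app (O.toCohomology ⟨Conv.app α h y, hy⟩) = Conv.app ρ.toConv h y :=
  mainTheorem8_general P O H φ hφ G ρ.toConv (Conv.isMCSprout_toConv G 2 ρ)
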